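/- **Model.** An instance is a connected $n$-node graph $G$ whose nodes carry the identifiers $0,\dots,n-1$; every node knows $n$, its identifier and the identifier of its parent in an arbitrary spanning tree of $G$ rooted at node $0$. In a *distributed interactive proof* with $r$ rounds and $\ell$-bit messages, the nodes (each with private random coins) and an untrusted, computationally unbounded, randomized prover that knows the whole instance alternate for $r$ rounds, the last one being the prover's; in a node round every node sends $\ell$ bits to the prover, in a prover round the prover sends $\ell$ bits to every node. Then, without the prover, the nodes run a synchronous distributed verification algorithm on $G$, and each node accepts or rejects. The proof is for a language $\mathcal L$ of instances if for every instance in $\mathcal L$ a fixed honest prover makes all nodes accept with probability at least $2/3$, and for every instance outside $\mathcal L$ and every prover all nodes accept with probability at most $1/3$. $\mathcal C[c,b]$ denotes the (randomized) distributed algorithms that run in $c$ synchronous rounds, neighbours exchanging messages of $b$ bits in each round. The *view* of a node consists of its coins, the messages exchanged with the prover, and the messages received from its neighbours during verification. The language $\mathcal L$ belongs to $\mathrm{dStatZK}[r,\ell,\mathcal C[c,b]]$ (with $r,\ell,c,b$ functions of $n$) if it has a distributed interactive proof with $r$ rounds, $\ell$-bit messages and verification algorithm in $\mathcal C[c,b]$,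 together with a simulator in $\mathcal C[c,b]$ (run by the nodes without any prover, each node outputting a simulated view) such that for every $d\in\mathbb N$, for all sufficiently large $n$, for every $n$-node instance in $\mathcal L$ and every node $v$, the total variation distance between the output of the simulator at $v$ and the view of $v$ in the interaction with the honest prover is at most $n^{-d}$. **Theorem.** Let $k$ be a fixed natural number, and let Non-$k$-Colorability be the language of all instances whose graph $G$ has no proper colouring with $k$ colours. For every sequence of primes $q=q(n)$ with $q=n^{\omega(1)}$ (that is, for every $d$, $q(n)\ge n^d$ for all large $n$), $$\text{Non-}k\text{-Colorability}\in \mathrm{dStatZK}\bigl[O(n),\,O(\log q),\,\mathcal C[O(1),\,O(n\log q)]\bigr],$$ where the constants in the $O$-notation depend only on $k$. -/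

import Mathlib

open Filter

noncomputable section

/-- Strings of exactly `b` bits. -/
abbrev BitString (b : ℕ) : Type := Fin b → Bool

/-! ### Networks -/

/-- An `n`-node network. A node is identified with its identifier in `{0, …, n - 1}`. Besides its
identifier, the input label of a node is the identifier of its parent in an arbitrary spanning tree
of the connected communication graph, rooted at the node with identifier `0` (the root is recorded
as its own parent). -/
structure Network (n : ℕ) where
  graph : SimpleGraph (Fin n)
  connected : graph.Connected
  parent : Fin n → Fin n
  parent_root : ∀ v : Fin n, v.val = 0 → parent v = v
  parent_adj : ∀ v : Fin n, v.val ≠ 0 → graph.Adj v (parent v)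
  parent_reaches_root : ∀ v : Fin n, ∃ m : ℕ, (parent^[m] v).val = 0

/-- What a node knows initially (everything may moreover depend on the number `n` of nodes). -/
structure LocalInput (n : ℕ) where
  id : Fin n
  parent : Fin n

def Network.localInput {n : ℕ} (X : Network n) (v : Fin n) : LocalInput n := ⟨v, X.parent v⟩

/-- A distributed language: a set of labelled networks, of all sizes. -/
abbrev DistLanguage : Type := (n : ℕ) → Set (Network n)

/-- The networks whose communication graph has no proper colouring with `k` colours. -/
def nonColorability (k : ℕ) : DistLanguage := fun _ => {X | ¬ X.graph.Colorable k}

/-! ### Synchronous distributed algorithms -/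

/-- The messages a node receives in one round, indexed by the identifier of the sender;
`none` for the nodes that are not neighbours. -/
abbrev Inbox (n b : ℕ) : Type := Fin n → Option (BitString b)

/-- A distributed algorithm with `b`-bit messages, executed by every node. A node starts in a local
state of type `σ`; the message it sends to the neighbour with a given identifier depends on its
state and on everything it received in the previous rounds, and so does its output. Local
computation is unrestricted. -/
structure DistAlgorithm (n b : ℕ) (σ ω : Type) where
  send : σ → List (Inbox n b) → Fin n → BitString b
  output : σ → List (Inbox n b) → ω

open Classical in
/-- The messages received by each node in the first `t` synchronous rounds. -/
def DistAlgorithm.received {n b : ℕ} {σ ω : Type} (A : DistAlgorithm n b σ ω)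
    (G : SimpleGraph (Fin n)) (init : Fin n → σ) : ℕ → Fin n → List (Inbox n b)
  | 0 => fun _ => []
  | t + 1 => fun v =>
      A.received G init t v ++
        [fun u => if G.Adj u v then some (A.send (init u) (A.received G init t u) v) else none]

/-- The output of node `v` after `c` rounds. -/
def DistAlgorithm.run {n b : ℕ} {σ ω : Type} (A : DistAlgorithm n b σ ω)
    (G : SimpleGraph (Fin n)) (init : Fin n → σ) (c : ℕ) (v : Fin n) : ω :=
  A.output (init v) (A.received G init c v)

/-! ### Distributed interactive proofs -/

/-- The distributed verifier. Every node draws its private coins uniformly and independently of the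
other nodes. In the interaction with the prover, each message of a node is a function of its input,
its coins and the messages it has exchanged with the prover so far. Afterwards the network runs the
verification algorithm, whose local states consist of input, coins and conversation with the
prover, and whose output is the decision of the node (`true` means accept). -/
structure DistVerifier (n l b : ℕ) where
  Coin : Type
  [fintypeCoin : Fintype Coin]
  [nonemptyCoin : Nonempty Coin]
  message : LocalInput n → Coin → List (BitString l) → BitString l
  verification : DistAlgorithm n b (LocalInput n × Coin × List (BitString l)) Bool

attribute [instance] DistVerifier.fintypeCoin DistVerifier.nonemptyCoin

/-- A prover (for one network, which it may depend on): a randomized strategy that, from the messages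
exchanged with all nodes so far, computes the next message for every node. -/
structure DistProver (n l : ℕ) where
  Coin : Type
  [fintypeCoin : Fintype Coin]
  [nonemptyCoin : Nonempty Coin]
  message : Coin → List (Fin n → BitString l) → Fin n → BitString l

attribute [instance] DistProver.fintypeCoin DistProver.nonemptyCoin

section Execution

variable {n l b : ℕ} (V : DistVerifier n l b) (P : DistProver n l) (X : Network n)

/-- The coins of all nodes and of the prover. -/
abbrev JointCoins : Type := (Fin n → V.Coin) × P.Coin

/-- The first `i` messages between each node and the prover in an interaction of `r` rounds.
The rounds of the prover and of the nodes alternate, and the last round is the prover's. -/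
def conversation (r : ℕ) (ρ : JointCoins V P) : ℕ → List (Fin n → BitString l)
  | 0 => []
  | i + 1 =>
      conversation r ρ i ++
        [if Odd (r - i) then P.message ρ.2 (conversation r ρ i)
         else fun v => V.message (X.localInput v) (ρ.1 v) ((conversation r ρ i).map (· v))]

/-- The state of a node when the verification algorithm starts. -/
def stateAfterInteraction (r : ℕ) (ρ : JointCoins V P) (v : Fin n) :
    LocalInput n × V.Coin × List (BitString l) :=
  (X.localInput v, ρ.1 v, (conversation V P X r ρ r).map (· v))

/-- The probability that all nodes accept, for `r` rounds of interaction and `c` rounds of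
verification. -/
def acceptProb (r c : ℕ) : ℝ :=
  ((PMF.uniformOfFintype (JointCoins V P)).toOuterMeasure
    {ρ | ∀ v, V.verification.run X.graph (stateAfterInteraction V P X r ρ) c v = true}).toReal

/-- The view of a node: its coins, its conversation with the prover, and all messages received from
its neighbours during verification. -/
abbrev NodeView : Type := V.Coin × List (BitString l) × List (Inbox n b)

/-- The distribution of the view of node `v`. -/
def viewDist (r c : ℕ) (v : Fin n) : PMF (NodeView V) :=
  (PMF.uniformOfFintype (JointCoins V P)).map fun ρ =>
    (ρ.1 v, (conversation V P X r ρ r).map (· v),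
      V.verification.received X.graph (stateAfterInteraction V P X r ρ) c v)

/-- A simulator: a randomized distributed algorithm, run by the network without any prover, in which
every node outputs a simulated view. -/
structure Simulator where
  Coin : Type
  [fintypeCoin : Fintype Coin]
  [nonemptyCoin : Nonempty Coin]
  algorithm : DistAlgorithm n b (LocalInput n × Coin) (NodeView V)

attribute [instance] Simulator.fintypeCoin Simulator.nonemptyCoin

/-- The distribution of the output of node `v` after `c` rounds of the simulator. -/
def simDist {V : DistVerifier n l b} (S : Simulator V) (X : Network n) (c : ℕ) (v : Fin n) :
    PMF (NodeView V) :=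
  (PMF.uniformOfFintype (Fin n → S.Coin)).map fun ρ =>
    S.algorithm.run X.graph (fun u => (X.localInput u, ρ u)) c v

end Execution

/-- Total variation distance of two discrete distributions. -/
def tvDist {α : Type} (p q : PMF α) : ℝ := (1 / 2) * ∑' x, |(p x).toReal - (q x).toReal|

/-- The verifiers `V n` with the honest provers `P n X` form a distributed interactive proof for `L`
with `r n` rounds of interaction and `c n` rounds of verification on `n`-node networks. -/
def IsDistInteractiveProof (r c l b : ℕ → ℕ) (V : (n : ℕ) → DistVerifier n (l n) (b n))
    (P : (n : ℕ) → Network n → DistProver n (l n)) (L : DistLanguage) : Prop :=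
  (∀ n, ∀ X ∈ L n, 2 / 3 ≤ acceptProb (V n) (P n X) X (r n) (c n)) ∧
  (∀ n, ∀ X ∉ L n, ∀ P' : DistProver n (l n), acceptProb (V n) P' X (r n) (c n) ≤ 1 / 3)

/-- On the networks in `L`, for every node, the simulated view and the view in the interaction with
the honest prover are statistically indistinguishable: their distance is smaller than every inverse
polynomial in the number of nodes. -/
def IsStatZeroKnowledge (r c l b : ℕ → ℕ) (V : (n : ℕ) → DistVerifier n (l n) (b n))
    (P : (n : ℕ) → Network n → DistProver n (l n)) (S : (n : ℕ) → Simulator (V n))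
    (L : DistLanguage) : Prop :=
  ∀ d : ℕ, ∀ᶠ n in atTop, ∀ X ∈ L n, ∀ v : Fin n,
    tvDist (simDist (S n) X (c n) v) (viewDist (V n) (P n X) X (r n) (c n) v) ≤ 1 / (n : ℝ) ^ d

/-- The class `dStatZK[r, l, C[c, b]]`: the distributed languages that have a statistical
zero-knowledge distributed interactive proof with `r` rounds of interaction and `l`-bit messages
between each node and the prover, whose verification algorithm and simulator both run in `c`
synchronous rounds with `b`-bit messages between neighbours. -/
def dStatZK (r l c b : ℕ → ℕ) : Set DistLanguage :=
  {L | ∃ (V : (n : ℕ) → DistVerifier n (l n) (b n))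
        (P : (n : ℕ) → Network n → DistProver n (l n)) (S : (n : ℕ) → Simulator (V n)),
      IsDistInteractiveProof r c l b V P L ∧ IsStatZeroKnowledge r c l b V P S L}

/-- `q(n) = n ^ ω(1)`. -/
def IsSuperpolynomial (q : ℕ → ℕ) : Prop := ∀ d : ℕ, ∀ᶠ n in atTop, n ^ d ≤ q n

end

noncomputable section

/-! Let `k` field elements (the grid) stand for colours. A graph fails to be `k`-colourable iff the
product of `x v - x u` over its edges vanishes at every grid point. The prover shows by a sumcheck,
one round per node, that a weighted sum of these values is zero, colour `a` of node `i` having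
weight `z i ^ a` for a random `z i`.

Soundness. At a proper colouring the edge product is nonzero, and going down through the partial
sums at that colouring, each random `z j` makes the next one vanish with probability at most `k / q`
(`ncard_weightEvent_le`). A wrong `j`-th sumcheck polynomial agrees with the right one at a later
random point with probability at most `n / m`, where `m` is the number of points a node chooses from
(`ncard_pointEvent_le`). All sumcheck equations are the coefficients of one polynomial of degree at
most `n + 1` in a challenge of the root, so testing them together costs at most `(n + 1) / q`
(`ncard_challengeEvent_le`). Outside these events no prover is accepted (`accept_subset`). The test
is linear in the sumcheck coefficients, so it can be computed from additive shares and summed along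
the spanning tree; the edge product at the random point is multiplied along the same tree.

Zero knowledge. The points of different nodes are always distinct, so all subtree products are
nonzero, and the random multipliers make them uniform units. Pads make the shares of a node uniform,
and masks do the same for the subtree totals except the root's, which is zero. The multiplier and
the mask of a node are then determined by its local equations. For `n ≥ 2` a bijection of the coins
turns the simulated view into the real one (`simulatedCoins_injective`, `viewOf_simulatedCoins`), so
the simulation is perfect (`simDist_eq_viewDist`). -/

namespace NonColorability

/-! ### Counting by resampling -/

/-- If, whatever the other coordinates, at most `d` values of one coordinate (read by `get` and
overwritten by `set`) lead into `B`, then `B` has density at most `d / |Y|`. -/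
theorem card_resample {Ω Y : Type} [Fintype Ω] [Fintype Y] (get : Ω → Y) (set : Ω → Y → Ω)
    (get_set : ∀ ω y, get (set ω y) = y) (set_get : ∀ ω, set ω (get ω) = ω)
    (set_set : ∀ ω y y', set (set ω y) y' = set ω y') (B : Set Ω) (d : ℕ)
    (hB : ∀ ω, {y | set ω y ∈ B}.ncard ≤ d) :
    B.ncard * Fintype.card Y ≤ d * Fintype.card Ω := by
  classical
  -- Exchanging the coordinate with an independent fresh copy is an involution, so `|B| * |Y|` also
  -- counts the pairs whose resampled outcome lies in `B`.
  let e : Ω × Y ≃ Ω × Y :=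
    { toFun := fun p => (set p.1 p.2, get p.1)
      invFun := fun p => (set p.1 p.2, get p.1)
      left_inv := fun p => by simp [get_set, set_get, set_set]
      right_inv := fun p => by simp [get_set, set_get, set_set] }
  have h1 : B.ncard * Fintype.card Y =
      ∑ ω : Ω, ∑ y : Y, (if set ω y ∈ B then 1 else 0) := by
    rw [← Fintype.sum_prod_type' (f := fun ω y => if set ω y ∈ B then 1 else 0)]
    refine Eq.trans ?_ (e.sum_comp fun p : Ω × Y => if p.1 ∈ B then 1 else 0).symm
    rw [Fintype.sum_prod_type, Finset.sum_comm]
    simp [Set.ncard_eq_toFinset_card', mul_comm]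
  rw [h1]
  calc _ ≤ ∑ _ω : Ω, d := Finset.sum_le_sum fun ω _ => by
        have := hB ω
        rw [Set.ncard_eq_toFinset_card'] at this
        simpa [Finset.sum_boole] using this
    _ = _ := by simp [mul_comm]

/-- `card_resample` for events that force a nonzero polynomial to vanish. -/
theorem card_resample_of_root {F Ω Y : Type} [Field F] [Fintype Ω] [Fintype Y]
    (get : Ω → Y) (set : Ω → Y → Ω)
    (get_set : ∀ ω y, get (set ω y) = y) (set_get : ∀ ω, set ω (get ω) = ω)
    (set_set : ∀ ω y y', set (set ω y) y' = set ω y') (B : Set Ω) (d : ℕ)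
    (φ : Y → F) (hφ : Function.Injective φ)
    (hB : ∀ ω ∈ B, ∃ p : Polynomial F, p ≠ 0 ∧ p.natDegree ≤ d ∧
      ∀ y, set ω y ∈ B → p.eval (φ y) = 0) :
    B.ncard * Fintype.card Y ≤ d * Fintype.card Ω := by
  classical
  refine card_resample get set get_set set_get set_set B d fun ω => ?_
  by_cases hne : ∃ y₀, set ω y₀ ∈ B
  · obtain ⟨y₀, hy₀⟩ := hne
    obtain ⟨p, hp, hdeg, hroot⟩ := hB _ hy₀
    calc {y | set ω y ∈ B}.ncard = (φ '' {y | set ω y ∈ B}).ncard :=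
          (Set.ncard_image_of_injective _ hφ).symm
      _ ≤ (p.roots.toFinset : Set F).ncard := by
          refine Set.ncard_le_ncard ?_ (Finset.finite_toSet _)
          rintro _ ⟨y, hy, rfl⟩
          have := hroot y (by rw [set_set]; exact hy)
          simpa [hp] using this
      _ ≤ d := by
          rw [Set.ncard_coe_finset]
          exact (Multiset.toFinset_card_le _).trans ((Polynomial.card_roots' p).trans hdeg)
  · have : {y | set ω y ∈ B} = ∅ := by
      ext y; simpa using fun h => hne ⟨y, h⟩
    simp [this]

/-! ### The edge product and its partial sums -/

section Algebra

variable {F : Type} [Field F] {n k : ℕ}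

open Classical in
/-- The contribution of the vertex `v`, with set of neighbours `N`, to the edge product. -/
def vertexFactor (N : Fin n → Prop) (x : Fin n → F) (v : Fin n) : F :=
  ∏ u, if N u ∧ u < v then x v - x u else 1

/-- The product of `x v - x u` over all edges `uv` with `u < v`. -/
def edgeProduct (G : SimpleGraph (Fin n)) (x : Fin n → F) : F :=
  ∏ v, vertexFactor (fun u => G.Adj u v) x v

/-- Evaluation points of distinct nodes never coincide, so the products formed along the tree are
units even when the edge product vanishes on the whole grid. -/
theorem vertexFactor_ne_zero (N : Fin n → Prop) {x : Fin n → F} (hx : Function.Injective x)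
    (v : Fin n) : vertexFactor N x v ≠ 0 := by
  refine Finset.prod_ne_zero_iff.2 fun u _ => ?_
  split_ifs with h
  · exact sub_ne_zero.2 fun e => h.2.ne' (hx e)
  · exact one_ne_zero

theorem edgeProduct_ne_zero_iff (G : SimpleGraph (Fin n)) (x : Fin n → F) :
    edgeProduct G x ≠ 0 ↔ ∀ u v, G.Adj u v → x u ≠ x v := by
  simp only [edgeProduct, vertexFactor, Finset.prod_ne_zero_iff, Finset.mem_univ, true_imp_iff]
  constructor
  · intro h u v huv e
    rcases lt_trichotomy u v with hlt | heq | hlt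
    · exact h v u (by rw [if_pos ⟨huv, hlt⟩, e, sub_self])
    · exact huv.ne heq
    · exact h u v (by rw [if_pos ⟨huv.symm, hlt⟩, e, sub_self])
  · intro h v u
    split_ifs with hc
    · exact sub_ne_zero.2 (h u v hc.1).symm
    · exact one_ne_zero

/-! ### Univariate restrictions of low degree -/

/-- A function given by a polynomial with `n` coefficients. -/
def IsPolyFun (n : ℕ) (φ : F → F) : Prop := ∃ c : Fin n → F, ∀ X, φ X = ∑ u, c u * X ^ (u : ℕ)

theorem IsPolyFun.of_polynomial {φ : F → F} (p : Polynomial F) (hp : p.natDegree < n)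
    (h : ∀ X, φ X = p.eval X) : IsPolyFun n φ :=
  ⟨fun u => p.coeff u, fun X => by
    rw [h, Polynomial.eval_eq_sum_range' hp, Finset.sum_range]⟩

theorem IsPolyFun.sum {ι : Type} (s : Finset ι) (φ : ι → F → F) (h : ∀ i, IsPolyFun n (φ i)) :
    IsPolyFun n fun X => ∑ i ∈ s, φ i X := by
  choose c hc using h
  refine ⟨fun u => ∑ i ∈ s, c i u, fun X => ?_⟩
  simp only [hc, Finset.sum_mul]
  exact Finset.sum_comm

theorem IsPolyFun.const_mul {φ : F → F} (h : IsPolyFun n φ) (a : F) :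
    IsPolyFun n fun X => a * φ X := by
  obtain ⟨c, hc⟩ := h
  exact ⟨fun u => a * c u, fun X => by simp only [hc, Finset.mul_sum, mul_assoc]⟩

theorem IsPolyFun.const (hn : 0 < n) (a : F) : IsPolyFun n fun _ : F => a :=
  .of_polynomial (Polynomial.C a) (by simpa using hn) (by simp)

open Classical in
/-- The coefficients of a polynomial function. -/
def coeffs (n : ℕ) (φ : F → F) : Fin n → F :=
  if h : IsPolyFun n φ then h.choose else 0

theorem IsPolyFun.eq_sum_coeffs {φ : F → F} (h : IsPolyFun n φ) (X : F) :
    φ X = ∑ u, coeffs n φ u * X ^ (u : ℕ) := by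
  rw [coeffs, dif_pos h]; exact h.choose_spec X

/-- Only the at most `n - 1` edges at `i` involve the variable, each linearly. Hence `n`
coefficients suffice, one for each node to hold. -/
theorem isPolyFun_edgeProduct (G : SimpleGraph (Fin n)) (x : Fin n → F) (i : Fin n) :
    IsPolyFun n fun X => edgeProduct G (Function.update x i X) := by
  classical
  let y : Fin n → Polynomial F := Function.update (fun v => Polynomial.C (x v)) i Polynomial.X
  let fac : Fin n × Fin n → Polynomial F := fun e =>
    if G.Adj e.1 e.2 ∧ e.1 < e.2 then y e.2 - y e.1 else 1
  have hy : ∀ X v, (y v).eval X = Function.update x i X v := by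
    intro X v
    by_cases hv : v = i
    · subst hv; simp [y]
    · simp [y, hv]
  have hdeg : ∀ e, (fac e).natDegree ≤ if e.1 < e.2 ∧ (e.1 = i ∨ e.2 = i) then 1 else 0 := by
    intro e
    have hd : ∀ v, (y v).natDegree ≤ if v = i then 1 else 0 := by
      intro v
      by_cases hv : v = i
      · subst hv; simp [y]
      · simp [y, hv]
    by_cases hc : G.Adj e.1 e.2 ∧ e.1 < e.2
    · simp only [fac, if_pos hc]
      refine (Polynomial.natDegree_sub_le _ _).trans (max_le ((hd _).trans ?_) ((hd _).trans ?_))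
      · split_ifs with h1 h2 <;> simp_all
      · split_ifs with h1 h2 <;> simp_all
    · simp [fac, if_neg hc]
  refine .of_polynomial (∏ e, fac e) ?_ fun X => ?_
  · have hn : 0 < n := i.pos
    refine lt_of_le_of_lt ((Polynomial.natDegree_prod_le _ _).trans
      (Finset.sum_le_sum fun e _ => hdeg e)) ?_
    rw [Finset.sum_boole]
    -- Each linear factor is charged to the endpoint other than `i`.
    have : ((Finset.univ.filter fun e : Fin n × Fin n =>
        e.1 < e.2 ∧ (e.1 = i ∨ e.2 = i)).card) ≤ (Finset.univ.erase i).card := by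
      refine Finset.card_le_card_of_injOn (fun e => if e.1 = i then e.2 else e.1) ?_ ?_
      · rintro ⟨a, b⟩ h
        simp at h ⊢
        grind
      · rintro ⟨a, b⟩ h ⟨a', b'⟩ h' e
        simp at h h' e ⊢
        grind
    simp at this ⊢
    omega
  · rw [Polynomial.eval_prod, Fintype.prod_prod_type_right]
    refine Finset.prod_congr rfl fun v _ => Finset.prod_congr rfl fun u _ => ?_
    simp only [fac]
    split_ifs <;> simp [hy]

/-! ### Weighted partial sums over the grid -/

/-- Sum of `f` over all grid values of the coordinates `i ≥ j`, the value `grid a` of coordinate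
`i` having weight `z i ^ a`. -/
def partialSum (grid : Fin k → F) (z : Fin n → F) (f : (Fin n → F) → F) (j : ℕ)
    (x : Fin n → F) : F :=
  if h : j < n then
    ∑ a : Fin k, z ⟨j, h⟩ ^ (a : ℕ) *
      partialSum grid z f (j + 1) (Function.update x ⟨j, h⟩ (grid a))
  else f x
termination_by n - j

variable (grid : Fin k → F) (z : Fin n → F) (f : (Fin n → F) → F)

theorem partialSum_succ (j : Fin n) (x : Fin n → F) :
    partialSum grid z f j x = ∑ a : Fin k, z j ^ (a : ℕ) *
      partialSum grid z f (j + 1) (Function.update x j (grid a)) := by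
  rw [partialSum, dif_pos j.isLt]

theorem partialSum_self (x : Fin n → F) : partialSum grid z f n x = f x := by
  rw [partialSum, dif_neg (lt_irrefl n)]

/-- Downward induction over the coordinates. -/
theorem descend {P : ℕ → Prop} (hn : P n) (hs : ∀ j : Fin n, P (j + 1) → P j) :
    ∀ j ≤ n, P j := fun _ hj =>
  Nat.decreasingInduction (motive := fun i _ => P i) (fun i hi h => hs ⟨i, hi⟩ h) hn hj

/-- The coordinates from `j` on are overwritten by grid values. Hence sumcheck polynomials do not
depend on points revealed later, and the full sum has no base point. -/
theorem partialSum_congr {j : ℕ} (hj : j ≤ n) : ∀ {x y : Fin n → F},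
    (∀ i : Fin n, (i : ℕ) < j → x i = y i) → partialSum grid z f j x = partialSum grid z f j y := by
  refine descend (P := fun j => ∀ {x y : Fin n → F}, (∀ i : Fin n, (i : ℕ) < j → x i = y i) →
    partialSum grid z f j x = partialSum grid z f j y) ?_ ?_ j hj
  · intro x y h
    rw [show x = y from funext fun i => h i i.isLt]
  · intro j ih x y h
    rw [partialSum_succ, partialSum_succ]
    refine Finset.sum_congr rfl fun a _ => ?_
    rw [ih (y := Function.update y j (grid a))]
    intro i hi
    by_cases hij : i = j
    · subst hij; simp
    · rw [Function.update_of_ne hij, Function.update_of_ne hij]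
      exact h i (by have := Fin.val_ne_of_ne hij; omega)

/-- Weights below `j` never enter; in particular, resampling `z j` leaves the partial sum at `j + 1`
unchanged. -/
theorem partialSum_congr_weights {z' : Fin n → F} {j : ℕ} (hj : j ≤ n) :
    (∀ i : Fin n, j ≤ i → z i = z' i) →
    ∀ x, partialSum grid z f j x = partialSum grid z' f j x := by
  refine descend (P := fun j => (∀ i : Fin n, j ≤ i → z i = z' i) →
    ∀ x, partialSum grid z f j x = partialSum grid z' f j x) ?_ ?_ j hj
  · intro _ x
    rw [partialSum_self, partialSum_self]
  · intro j ih h x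
    rw [partialSum_succ, partialSum_succ]
    refine Finset.sum_congr rfl fun a _ => ?_
    rw [h j le_rfl, ih fun i hi => h i (by omega)]

theorem partialSum_eq_zero {j : ℕ} (hj : j ≤ n)
    (hf : ∀ x : Fin n → F, (∀ i, x i ∈ Set.range grid) → f x = 0) : ∀ x : Fin n → F,
    (∀ i : Fin n, (i : ℕ) < j → x i ∈ Set.range grid) → partialSum grid z f j x = 0 := by
  refine descend (P := fun j => ∀ x : Fin n → F, (∀ i : Fin n, (i : ℕ) < j → x i ∈ Set.range grid) →
    partialSum grid z f j x = 0) ?_ ?_ j hj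
  · intro x h
    rw [partialSum_self, hf x fun i => h i i.isLt]
  · intro j ih x h
    rw [partialSum_succ]
    refine Finset.sum_eq_zero fun a _ => ?_
    rw [ih, mul_zero]
    intro i hi
    by_cases hij : i = j
    · subst hij; simp
    · rw [Function.update_of_ne hij]
      exact h i (by have := Fin.val_ne_of_ne hij; omega)

theorem isPolyFun_partialSum {i : Fin n}
    (hf : ∀ x, IsPolyFun n fun X => f (Function.update x i X)) {j : ℕ} (hj : j ≤ n) :
    ∀ x, IsPolyFun n fun X => partialSum grid z f j (Function.update x i X) := by
  refine descend (P := fun j => ∀ x, IsPolyFun n fun X =>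
    partialSum grid z f j (Function.update x i X)) ?_ ?_ j hj
  · simpa only [partialSum_self] using hf
  · intro j ih x
    simp only [partialSum_succ]
    refine .sum _ _ fun a => .const_mul ?_ _
    by_cases hij : i = j
    · subst hij
      -- The variable is overwritten by the summation, so the summand is constant in it.
      simp only [Function.update_idem]
      exact .const i.pos _
    · simp only [Function.update_comm hij]
      exact ih _

end Algebra

/-! ### Subtrees -/

section Tree

variable {n : ℕ} (X : Network n)

/-- The root of the spanning tree. -/
def root : Fin n := ⟨0, X.connected.nonempty.some.pos⟩

theorem eq_root_iff {v : Fin n} : v = root X ↔ v.val = 0 := by simp [root, Fin.ext_iff]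

open Classical in
/-- The children of a node in the spanning tree. -/
def children (v : Fin n) : Finset (Fin n) := {u | X.graph.Adj u v ∧ X.parent u = v}

theorem mem_children {u v : Fin n} : u ∈ children X v ↔ u ≠ root X ∧ X.parent u = v := by
  simp only [children, Finset.mem_filter, Finset.mem_univ, true_and]
  constructor
  · rintro ⟨h, rfl⟩
    exact ⟨fun e => h.ne (X.parent_root u ((eq_root_iff X).1 e)).symm, rfl⟩
  · rintro ⟨h, rfl⟩
    exact ⟨X.parent_adj u (mt (eq_root_iff X).2 h), rfl⟩

open Classical in
/-- The nodes whose path to the root passes through `v`. -/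
def subtree (v : Fin n) : Finset (Fin n) := {u | ∃ m : ℕ, X.parent^[m] u = v}

theorem mem_subtree {u v : Fin n} : u ∈ subtree X v ↔ ∃ m : ℕ, X.parent^[m] u = v := by
  simp [subtree]

theorem parent_iterate_root (m : ℕ) : X.parent^[m] (root X) = root X :=
  Function.iterate_fixed (X.parent_root _ rfl) m

/-- Going round the cycle `d` times, with `d` the number of steps from `v` to the root, passes
through the root and stays there. -/
theorem eq_root_of_iterate {v : Fin n} {m : ℕ} (h : X.parent^[m + 1] v = v) : v = root X := by
  obtain ⟨d, hd⟩ := X.parent_reaches_root v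
  have hper : X.parent^[(m + 1) * d] v = v := by
    rw [Function.iterate_mul]; exact Function.iterate_fixed h d
  rw [show (m + 1) * d = m * d + d by ring, Function.iterate_add_apply,
    (eq_root_iff X).2 hd, parent_iterate_root] at hper
  exact hper.symm

theorem subtree_root : subtree X (root X) = Finset.univ := by
  ext u
  obtain ⟨m, hm⟩ := X.parent_reaches_root u
  simpa [mem_subtree] using ⟨m, (eq_root_iff X).2 hm⟩

theorem subtree_eq (v : Fin n) :
    subtree X v = insert v ((children X v).biUnion (subtree X)) := by
  ext u
  simp only [mem_subtree, Finset.mem_insert, Finset.mem_biUnion, mem_children]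
  constructor
  · rintro ⟨m, hm⟩
    induction m with
    | zero => exact .inl hm
    | succ m ih =>
      rw [Function.iterate_succ_apply'] at hm
      by_cases hr : X.parent^[m] u = root X
      · refine ih ?_
        rw [← hm, hr, X.parent_root _ rfl]
      · exact .inr ⟨_, ⟨hr, hm⟩, m, rfl⟩
  · rintro (rfl | ⟨c, ⟨_, rfl⟩, m, rfl⟩)
    · exact ⟨0, rfl⟩
    · exact ⟨m + 1, Function.iterate_succ_apply' _ _ _⟩

theorem notMem_children_subtree (v : Fin n) : v ∉ (children X v).biUnion (subtree X) := by
  simp only [mem_subtree, Finset.mem_biUnion, mem_children, not_exists, not_and]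
  rintro c ⟨hc, rfl⟩ m hm
  exact hc (eq_root_of_iterate X (m := m) (by rw [Function.iterate_succ_apply]; exact hm))

theorem children_pairwiseDisjoint (v : Fin n) :
    (children X v : Set (Fin n)).PairwiseDisjoint (subtree X) := by
  -- If the path of `u` meets `c` and later `c'`, it visits `v` in between and again after `c'`. So
  -- `v` lies on a cycle and is the root, which forces `c'` to be the root as well.
  have key : ∀ c ∈ children X v, ∀ c' ∈ children X v, ∀ u : Fin n, ∀ a b : ℕ, a < b →
      X.parent^[a] u = c → X.parent^[b] u = c' → False := by
    intro c hc c' hc' u a b hab ha hb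
    rw [mem_children] at hc hc'
    obtain ⟨d, rfl⟩ := Nat.exists_eq_add_of_lt hab
    rw [show a + d + 1 = (d + 1) + a by ring, Function.iterate_add_apply, ha,
      Function.iterate_succ_apply, hc.2] at hb
    have hv : v = root X := eq_root_of_iterate X (m := d) (by
      rw [Function.iterate_succ_apply', hb, hc'.2])
    rw [hv, parent_iterate_root] at hb
    exact hc'.1 hb.symm
  intro c hc c' hc' hne
  rw [Function.onFun, Finset.disjoint_left]
  intro u hu hu'
  obtain ⟨a, ha⟩ := (mem_subtree X).1 hu
  obtain ⟨b, hb⟩ := (mem_subtree X).1 hu'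
  rcases lt_trichotomy a b with h | h | h
  · exact key c hc c' hc' u a b h ha hb
  · exact hne (by rw [← ha, ← hb, h])
  · exact key c' hc' c hc u b a h hb ha

theorem prod_subtree {M : Type} [CommMonoid M] (g : Fin n → M) (v : Fin n) :
    ∏ u ∈ subtree X v, g u = g v * ∏ c ∈ children X v, ∏ u ∈ subtree X c, g u := by
  rw [subtree_eq, Finset.prod_insert (notMem_children_subtree X v),
    Finset.prod_biUnion (children_pairwiseDisjoint X v)]

theorem sum_subtree {M : Type} [AddCommMonoid M] (g : Fin n → M) (v : Fin n) :
    ∑ u ∈ subtree X v, g u = g v + ∑ c ∈ children X v, ∑ u ∈ subtree X c, g u := by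
  rw [subtree_eq, Finset.sum_insert (notMem_children_subtree X v),
    Finset.sum_biUnion (children_pairwiseDisjoint X v)]

/-- The children of all nodes are all nodes but the root. -/
theorem prod_children {M : Type} [CommMonoid M] (g : Fin n → M) :
    g (root X) * ∏ v, ∏ c ∈ children X v, g c = ∏ v, g v := by
  classical
  rw [← Finset.mul_prod_erase Finset.univ g (Finset.mem_univ (root X)),
    ← Finset.prod_fiberwise (Finset.univ.erase (root X)) X.parent g]
  congr 1
  refine Finset.prod_congr rfl fun v _ => Finset.prod_congr ?_ fun _ _ => rfl
  ext c
  simp [mem_children]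

theorem sum_children {M : Type} [AddCommMonoid M] (g : Fin n → M) :
    g (root X) + ∑ v, ∑ c ∈ children X v, g c = ∑ v, g v :=
  prod_children (M := Multiplicative M) X g

end Tree

/-! ### Conversations -/

section Conversation

variable {n l b : ℕ} (V : DistVerifier n l b) (P : DistProver n l) (X : Network n) (r : ℕ)

/-- The messages of round `j`. -/
def messageAt (ρ : JointCoins V P) (j : ℕ) : Fin n → BitString l :=
  if Odd (r - j) then P.message ρ.2 (conversation V P X r ρ j)
  else fun v => V.message (X.localInput v) (ρ.1 v) ((conversation V P X r ρ j).map (· v))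

theorem conversation_eq_map (ρ : JointCoins V P) (i : ℕ) :
    conversation V P X r ρ i = (List.range i).map (messageAt V P X r ρ) := by
  induction i with
  | zero => rfl
  | succ i ih => rw [List.range_succ, List.map_append, ← ih]; rfl

theorem length_conversation (ρ : JointCoins V P) (i : ℕ) :
    (conversation V P X r ρ i).length = i := by simp [conversation_eq_map]

theorem getD_conversation (ρ : JointCoins V P) {i j : ℕ} (h : j < i) (d : Fin n → BitString l) :
    (conversation V P X r ρ i).getD j d = messageAt V P X r ρ j := by
  simp [conversation_eq_map, h]

/-- Coins act only through messages already sent. This is what makes the prover's earlier messages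
independent of a coin that is revealed later. -/
theorem conversation_congr {ρ ρ' : JointCoins V P} (hP : ρ.2 = ρ'.2) (i : ℕ)
    (hV : ∀ v L, L.length < i →
      V.message (X.localInput v) (ρ.1 v) L = V.message (X.localInput v) (ρ'.1 v) L) :
    conversation V P X r ρ i = conversation V P X r ρ' i := by
  induction i with
  | zero => rfl
  | succ i ih =>
    have ih' := ih fun v L hL => hV v L (by omega)
    simp only [conversation, ih', hP]
    congr 2
    split_ifs
    · rfl
    · funext v
      exact hV v _ (by rw [List.length_map, length_conversation]; omega)

theorem messageAt_congr {ρ ρ' : JointCoins V P} (hP : ρ.2 = ρ'.2) {i j : ℕ} (hj : j < i)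
    (hV : ∀ v L, L.length < i →
      V.message (X.localInput v) (ρ.1 v) L = V.message (X.localInput v) (ρ'.1 v) L) :
    messageAt V P X r ρ j = messageAt V P X r ρ' j := by
  rw [← getD_conversation V P X r ρ hj default, conversation_congr V P X r hP i hV,
    getD_conversation V P X r ρ' hj default]

end Conversation

/-! ### The protocol -/

/-- The private coins of a node: the base of the weights in the sum over its colours, a random
multiplier, the index of its evaluation point, and a challenge (used only by the root). -/
abbrev NodeCoin (F : Type) [Field F] (m : ℕ) : Type := F × Fˣ × Fin m × F

/-- A message between neighbours: weights, points and challenge as announced by the prover, and the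
product and the total of the subtree of the sender. -/
abbrev EdgeMessage (F : Type) (n : ℕ) : Type := (Fin n → F) × (Fin n → F) × F × F × F

/-- What a node is told by the prover. The coefficients of the `j`-th sumcheck polynomial are
additively shared: the node `v` gets one share of the coefficient `v` and one share of the
coefficient `finRotate n v`. -/
@[ext]
structure Transcript (F : Type) (n : ℕ) where
  shareLeft : Fin n → F
  shareRight : Fin n → F
  weights : Fin n → F
  points : Fin n → F
  mask : F
  product : F
  total : F
  challenge : F

/-- The parameters of the protocol: for every node a set of evaluation points, disjoint from those
of the other nodes, the field elements that represent colours, and the encodings of messages. -/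
structure Setup (F : Type) (n m k l b : ℕ) where
  point : Fin n → Fin m → F
  point_inj : ∀ {u v i j}, point u i = point v j → u = v ∧ i = j
  grid : Fin k → F
  grid_inj : Function.Injective grid
  enc : (Fin 4 → F) → BitString l
  dec : BitString l → Fin 4 → F
  dec_enc : ∀ a, dec (enc a) = a
  encEdge : EdgeMessage F n → BitString b
  decEdge : BitString b → EdgeMessage F n
  decEdge_encEdge : ∀ a, decEdge (encEdge a) = a

section Transcript

variable {F : Type} {n k : ℕ}

/-- The message of the prover in its round `t`. -/
def Transcript.pack [Zero F] (T : Transcript F n) (t : ℕ) : Fin 4 → F :=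
  -- Round `t < n` carries the shares of the `t`-th polynomial, round `n + 1` the product and the
  -- total. Weights and points lag by one round, since node `j` reveals its point only in round `j +
  -- 1`; the slot after the last weight holds the challenge.
  ![if h : t < n then T.shareLeft ⟨t, h⟩ else if t = n then 0 else T.product,
    if h : t < n then T.shareRight ⟨t, h⟩ else if t = n then 0 else T.total,
    if t = 0 then T.mask else if h : t - 1 < n then T.weights ⟨t - 1, h⟩ else T.challenge,
    if t = 0 then 0 else if h : t - 1 < n then T.points ⟨t - 1, h⟩ else 0]

/-- The transcript with given messages of the prover. -/
def Transcript.unpack (w : ℕ → Fin 4 → F) : Transcript F n where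
  shareLeft j := w j 0
  shareRight j := w j 1
  weights j := w (j + 1) 2
  points j := w (j + 1) 3
  mask := w 0 2
  product := w (n + 1) 0
  total := w (n + 1) 1
  challenge := w (n + 1) 2

theorem Transcript.unpack_congr {w w' : ℕ → Fin 4 → F} (h : ∀ t ≤ n + 1, w t = w' t) :
    (unpack w : Transcript F n) = unpack w' := by
  ext j <;> simp only [unpack] <;> rw [h _ (by omega)]

theorem Transcript.unpack_pack [Zero F] (T : Transcript F n) : unpack T.pack = T := by
  ext j <;> simp [unpack, pack]

/-- The factor by which the shares of the coefficient `u` of the `j`-th sumcheck polynomial are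
multiplied in the global linear test. -/
def testCoeff [Field F] (grid : Fin k → F) (z r : Fin n → F) (τ : F) (j u : Fin n) : F :=
  τ ^ (j + 1 : ℕ) * ∑ a : Fin k, z j ^ (a : ℕ) * grid a ^ (u : ℕ) - τ ^ (j + 2 : ℕ) * r j ^ (u : ℕ)

/-- The summand of a node in the global linear test, up to the mask. -/
def contribution [Field F] (grid : Fin k → F) (T : Transcript F n) (v : Fin n) : F :=
  ∑ j, (T.shareLeft j * testCoeff grid T.weights T.points T.challenge j v +
    T.shareRight j * testCoeff grid T.weights T.points T.challenge j (finRotate n v)) +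
  if v.val = 0 then T.challenge ^ (n + 1) * T.product else 0

/-- What a node with parent `p` sends to its neighbour `v`. -/
def edgeMessage [Field F] (p : Fin n) (T : Transcript F n) (v : Fin n) : EdgeMessage F n :=
  (T.weights, T.points, T.challenge, if p = v then T.product else 1, if p = v then T.total else 0)

end Transcript

namespace Setup

variable {F : Type} [Field F] {n m k l b : ℕ} (S : Setup F n m k l b)

/-- The message of a node in its round `t`. -/
def nodeMessage (v : Fin n) (c : NodeCoin F m) (t : ℕ) : Fin 4 → F :=
  if t = 0 then ![c.1, c.2.1, 0, 0]
  -- By now the prover has committed to the `v`-th sumcheck polynomial, in its round `v`.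
  else if t = v + 1 then ![S.point v c.2.2.1, 0, 0, 0]
  else if t = n + 1 ∧ v.val = 0 then ![c.2.2.2, 0, 0, 0]
  else 0

/-- The decision of a node, from its coins, its transcript and the messages of its neighbours. -/
def Accepts (v : Fin n) (c : NodeCoin F m) (T : Transcript F n)
    (I : Fin n → Option (EdgeMessage F n)) : Prop :=
  (∀ u, ∀ M ∈ I u, M.1 = T.weights ∧ M.2.1 = T.points ∧ M.2.2.1 = T.challenge) ∧
  c.1 = T.weights v ∧ S.point v c.2.2.1 = T.points v ∧ (v.val = 0 → c.2.2.2 = T.challenge) ∧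
  -- Soundness cancels the products of all non-root nodes, so these must not vanish.
  T.product ≠ 0 ∧
  T.product = c.2.1 * vertexFactor (fun u => (I u).isSome) T.points v *
    (∏ u, (I u).elim 1 fun M => M.2.2.2.1) ∧
  T.total = T.mask + contribution S.grid T v + (∑ u, (I u).elim 0 fun M => M.2.2.2.2) ∧
  (v.val = 0 → T.total = 0)

/-- The transcript of a node, read off its conversation with the prover. -/
def readTranscript (L : List (BitString l)) : Transcript F n :=
  .unpack fun t => S.dec (L.getD (2 * t + 1) default)

open Classical in
/-- The messages that `v` receives during verification, decoded. -/
def inbox (X : Network n) (T : Fin n → Transcript F n) (v : Fin n) :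
    Fin n → Option (EdgeMessage F n) :=
  fun u => if X.graph.Adj u v then some (edgeMessage (X.parent u) (T u) v) else none

theorem accepts_inbox_iff (X : Network n) (v : Fin n) (c : NodeCoin F m) (T : Fin n → Transcript F n) :
    S.Accepts v c (T v) (inbox X T v) ↔
      (∀ u, X.graph.Adj u v → (T u).weights = (T v).weights ∧ (T u).points = (T v).points ∧
        (T u).challenge = (T v).challenge) ∧
      c.1 = (T v).weights v ∧ S.point v c.2.2.1 = (T v).points v ∧
      (v.val = 0 → c.2.2.2 = (T v).challenge) ∧ (T v).product ≠ 0 ∧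
      (T v).product = c.2.1 * vertexFactor (fun u => X.graph.Adj u v) (T v).points v *
        ∏ u ∈ children X v, (T u).product ∧
      (T v).total = (T v).mask + contribution S.grid (T v) v +
        ∑ u ∈ children X v, (T u).total ∧
      (v.val = 0 → (T v).total = 0) := by
  classical
  have h1 : (fun u => ((inbox X T v u).isSome : Prop)) = fun u => X.graph.Adj u v := by
    funext u; by_cases h : X.graph.Adj u v <;> simp [inbox, h]
  have h2 : ∏ u, ((inbox X T v u).elim 1 fun M => M.2.2.2.1) =
      ∏ u ∈ children X v, (T u).product := by
    rw [children, Finset.prod_filter]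
    refine Finset.prod_congr (by simp) fun u _ => ?_
    by_cases h : X.graph.Adj u v <;> simp [inbox, h, edgeMessage]
  have h3 : ∑ u, ((inbox X T v u).elim 0 fun M => M.2.2.2.2) =
      ∑ u ∈ children X v, (T u).total := by
    rw [children, Finset.sum_filter]
    refine Finset.sum_congr (by simp) fun u _ => ?_
    by_cases h : X.graph.Adj u v <;> simp [inbox, h, edgeMessage]
  unfold Accepts
  rw [h1, h2, h3]
  refine and_congr_left fun _ => forall_congr' fun u => ?_
  by_cases h : X.graph.Adj u v <;> simp [inbox, h, edgeMessage]

variable [Fintype F] [DecidableEq F] [NeZero m]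

open Classical in
/-- The distributed verifier. -/
abbrev verifier : DistVerifier n l b where
  Coin := NodeCoin F m
  message I c L := S.enc (S.nodeMessage I.id c (L.length / 2))
  verification :=
    { send := fun s _ v => S.encEdge (edgeMessage s.1.parent (S.readTranscript s.2.2) v)
      output := fun s I => decide (S.Accepts s.1.id s.2.1 (S.readTranscript s.2.2)
        fun u => (I.headD (fun _ => none) u).map S.decEdge) }

/-- The number of rounds of interaction. -/
abbrev rounds (n : ℕ) : ℕ := 2 * (n + 2)

variable (P : DistProver n l) (X : Network n)

/-- The transcript of node `v` in an interaction with the prover `P`. -/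
def transcript (ρ : JointCoins S.verifier P) (v : Fin n) : Transcript F n :=
  .unpack fun t => S.dec (messageAt S.verifier P X (rounds n) ρ (2 * t + 1) v)

theorem readTranscript_conversation (ρ : JointCoins S.verifier P) (v : Fin n) :
    S.readTranscript ((conversation S.verifier P X (rounds n) ρ (rounds n)).map (· v)) =
      S.transcript P X ρ v := by
  refine Transcript.unpack_congr fun t ht => ?_
  rw [conversation_eq_map, List.map_map]
  congr 1
  have h : 2 * t + 1 < rounds n := by simp only [rounds]; omega
  simp [h]

theorem received_eq (ρ : JointCoins S.verifier P) (v : Fin n) :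
    S.verifier.verification.received X.graph
      (stateAfterInteraction S.verifier P X (rounds n) ρ) 1 v =
    [fun u => (inbox X (S.transcript P X ρ) v u).map S.encEdge] := by
  simp only [DistAlgorithm.received, List.nil_append, List.cons.injEq, and_true]
  funext u
  simp only [inbox]
  split_ifs
  · rw [Option.map_some, ← readTranscript_conversation]
    rfl
  · rfl

theorem run_eq_true_iff (ρ : JointCoins S.verifier P) (v : Fin n) :
    S.verifier.verification.run X.graph
      (stateAfterInteraction S.verifier P X (rounds n) ρ) 1 v = true ↔
    S.Accepts v (ρ.1 v) (S.transcript P X ρ v) (inbox X (S.transcript P X ρ) v) := by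
  rw [DistAlgorithm.run, received_eq]
  have h : (fun u => ((inbox X (S.transcript P X ρ) v u).map S.encEdge).map S.decEdge) =
      inbox X (S.transcript P X ρ) v := by
    funext u
    rw [Option.map_map, show S.decEdge ∘ S.encEdge = id from funext S.decEdge_encEdge]
    simp
  conv_rhs => rw [← h, ← readTranscript_conversation]
  exact @decide_eq_true_iff _ (Classical.propDecidable _)

end Setup

/-! ### The global linear test -/

section LinearTest

variable {F : Type} [Field F] {n k : ℕ}

/-- The polynomial function with given coefficients. -/
def polyEval (c : Fin n → F) (x : F) : F := ∑ u, c u * x ^ (u : ℕ)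

/-- The coefficient `u` of the `j`-th sumcheck polynomial, reconstructed from its shares. -/
def sharedCoeff (T : Fin n → Transcript F n) (j u : Fin n) : F :=
  (T u).shareLeft j + (T ((finRotate n).symm u)).shareRight j

theorem sum_mul_testCoeff (grid : Fin k → F) (z r : Fin n → F) (τ : F) (j : Fin n) (c : Fin n → F) :
    ∑ u, c u * testCoeff grid z r τ j u =
      τ ^ (j + 1 : ℕ) * ∑ a : Fin k, z j ^ (a : ℕ) * polyEval c (grid a) -
        τ ^ (j + 2 : ℕ) * polyEval c (r j) := by
  simp only [testCoeff, polyEval, mul_sub, Finset.sum_sub_distrib, Finset.mul_sum]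
  congr 1
  · rw [Finset.sum_comm]
    exact Finset.sum_congr rfl fun a _ => Finset.sum_congr rfl fun u _ => by ring
  · exact Finset.sum_congr rfl fun u _ => by ring

/-- By linearity the shares may be tested separately; reindexing the right shares by the rotation
joins them to the left shares of the same coefficient. -/
theorem sum_contribution (grid : Fin k → F) (X : Network n) (T : Fin n → Transcript F n)
    (z r : Fin n → F) (τ : F) (hz : ∀ v, (T v).weights = z) (hr : ∀ v, (T v).points = r)
    (hτ : ∀ v, (T v).challenge = τ) :
    ∑ v, contribution grid (T v) v =
      ∑ j : Fin n, (τ ^ (j + 1 : ℕ) * ∑ a : Fin k, z j ^ (a : ℕ) * polyEval (sharedCoeff T j) (grid a) -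
        τ ^ (j + 2 : ℕ) * polyEval (sharedCoeff T j) (r j)) +
      τ ^ (n + 1) * (T (root X)).product := by
  simp only [contribution, hz, hr, hτ]
  rw [Finset.sum_add_distrib]
  congr 1
  · rw [Finset.sum_comm]
    refine Finset.sum_congr rfl fun j _ => ?_
    rw [← sum_mul_testCoeff, Finset.sum_add_distrib,
      ← Equiv.sum_comp (finRotate n) fun u => sharedCoeff T j u * testCoeff grid z r τ j u]
    simp only [sharedCoeff, Equiv.symm_apply_apply, add_mul, Finset.sum_add_distrib]
    rw [Equiv.sum_comp (finRotate n) fun u => (T u).shareLeft j * testCoeff grid z r τ j u]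
  · simp_rw [← eq_root_iff X]
    simp

/-- The value passed to the `j`-th sumcheck step: zero in the first step, and `B (j - 1)` later. -/
def claim (B : Fin n → F) : ℕ → F
  | 0 => 0
  | j + 1 => if h : j < n then B ⟨j, h⟩ else 0

/-- The left-hand side of the global linear test as a polynomial in the challenge. -/
def testPoly (a : F) (A B : Fin n → F) (f : F) : Polynomial F :=
  .C a + ∑ i ∈ Finset.range (n + 1),
    .C ((if h : i < n then A ⟨i, h⟩ else f) - claim B i) * .X ^ (i + 1)

theorem eval_testPoly (a : F) (A B : Fin n → F) (f τ : F) :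
    (testPoly a A B f).eval τ =
      a + (∑ j : Fin n, (τ ^ (j + 1 : ℕ) * A j - τ ^ (j + 2 : ℕ) * B j) + τ ^ (n + 1) * f) := by
  simp only [testPoly, Polynomial.eval_add, Polynomial.eval_C, Polynomial.eval_finsetSum,
    Polynomial.eval_mul, Polynomial.eval_pow, Polynomial.eval_X, sub_mul, Finset.sum_sub_distrib]
  congr 1
  rw [Finset.sum_range_succ, Finset.sum_range_succ', Finset.sum_range, Finset.sum_range]
  simp only [claim, Fin.is_lt, dif_pos, lt_irrefl, dif_neg, not_false_eq_true, Fin.eta]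
  simp only [mul_comm (A _), mul_comm (B _), mul_comm f, add_assoc]
  ring

theorem natDegree_testPoly (a : F) (A B : Fin n → F) (f : F) :
    (testPoly a A B f).natDegree ≤ n + 1 := by
  refine Polynomial.natDegree_add_le_of_degree_le (by simp)
    (Polynomial.natDegree_sum_le_of_forall_le _ _ fun i hi => ?_)
  refine (Polynomial.natDegree_C_mul_X_pow_le _ _).trans ?_
  have := Finset.mem_range.1 hi
  omega

/-- The powers of the challenge separate the equations: coefficient `i + 1` compares the grid sum of
step `i` (the edge product for `i = n`) with the value passed on by step `i - 1`. The masks affect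
only the constant term. -/
theorem coeff_testPoly (a : F) (A B : Fin n → F) (f : F) {i : ℕ} (hi : i < n + 1) :
    (testPoly a A B f).coeff (i + 1) = (if h : i < n then A ⟨i, h⟩ else f) - claim B i := by
  rw [testPoly, Polynomial.coeff_add, Polynomial.coeff_C_succ, Polynomial.finsetSum_coeff]
  simp only [Polynomial.coeff_C_mul, Polynomial.coeff_X_pow, Nat.add_right_cancel_iff, mul_ite,
    mul_one, mul_zero, Finset.sum_ite_eq, Finset.mem_range, hi, if_true, zero_add]

end LinearTest

/-! ### Soundness -/

namespace Setup

variable {F : Type} [Field F] {n m k l b : ℕ} (S : Setup F n m k l b)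

/-- The evaluation points selected by the coins. -/
def points (ω : Fin n → NodeCoin F m) (v : Fin n) : F := S.point v (ω v).2.2.1

theorem points_injective (ω : Fin n → NodeCoin F m) : Function.Injective (S.points ω) :=
  fun _ _ h => (S.point_inj h).1

/-- The edge product, scaled by the product of all multipliers. -/
def scaledProduct (G : SimpleGraph (Fin n)) (mult : Fin n → F) (x : Fin n → F) : F :=
  (∏ v, mult v) * edgeProduct G x

/-- The partial sums of the scaled edge product. -/
def honestSum (X : Network n) (z mult : Fin n → F) (j : ℕ) (x : Fin n → F) : F :=
  partialSum S.grid z (scaledProduct X.graph mult) j x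

theorem isPolyFun_honestSum (X : Network n) (z mult x : Fin n → F) (i : Fin n) {j : ℕ}
    (hj : j ≤ n) : IsPolyFun n fun c => S.honestSum X z mult j (Function.update x i c) :=
  isPolyFun_partialSum _ _ _ (fun x => (isPolyFun_edgeProduct X.graph x i).const_mul _) hj x

/-- The weight bases selected by the coins. -/
def coinWeights (ω : Fin n → NodeCoin F m) : Fin n → F := fun v => (ω v).1

/-- The multipliers selected by the coins. -/
def coinMults (ω : Fin n → NodeCoin F m) : Fin n → F := fun v => (ω v).2.1

/-- Connectivity makes the announced weights, points and challenge global, and each node vouches for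
its own entries, so they are the coins. Multiplying or adding the local tree equations over all
nodes leaves only the term of the root. -/
theorem accept_consequences (X : Network n) (ω : Fin n → NodeCoin F m) (T : Fin n → Transcript F n)
    (h : ∀ v, S.Accepts v (ω v) (T v) (inbox X T v)) :
    (testPoly (∑ v, (T v).mask)
      (fun j => ∑ a : Fin k, (ω j).1 ^ (a : ℕ) * polyEval (sharedCoeff T j) (S.grid a))
      (fun j => polyEval (sharedCoeff T j) (S.points ω j))
      (scaledProduct X.graph (coinMults ω) (S.points ω))).eval (ω (root X)).2.2.2 = 0 := by
  simp only [accepts_inbox_iff] at h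
  have hconn : ∀ {α : Type} (φ : Fin n → α), (∀ u v, X.graph.Adj u v → φ u = φ v) →
      ∀ u v, φ u = φ v := by
    intro α φ hφ u v
    obtain ⟨w⟩ := X.connected.preconnected u v
    induction w with
    | nil => rfl
    | cons hadj _ ih => exact (hφ _ _ hadj).trans ih
  have hz : ∀ v, (T v).weights = coinWeights ω := fun v => funext fun u => by
    rw [hconn (fun v => (T v).weights) (fun u v huv => ((h v).1 u huv).1) v u]
    exact (h u).2.1.symm
  have hr : ∀ v, (T v).points = S.points ω := fun v => funext fun u => by
    rw [hconn (fun v => (T v).points) (fun u v huv => ((h v).1 u huv).2.1) v u]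
    exact (h u).2.2.1.symm
  have hτ : ∀ v, (T v).challenge = (ω (root X)).2.2.2 := fun v => by
    rw [hconn (fun v => (T v).challenge) (fun u v huv => ((h v).1 u huv).2.2) v (root X)]
    exact ((h (root X)).2.2.2.1 rfl).symm
  have hP : (T (root X)).product = scaledProduct X.graph (coinMults ω) (S.points ω) := by
    have h1 := prod_children X fun v => (T v).product
    have h2 : ∏ v, (T v).product = scaledProduct X.graph (coinMults ω) (S.points ω) *
        ∏ v, ∏ c ∈ children X v, (T c).product := by
      rw [scaledProduct, edgeProduct, ← Finset.prod_mul_distrib, ← Finset.prod_mul_distrib]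
      refine Finset.prod_congr rfl fun v _ => ?_
      rw [(h v).2.2.2.2.2.1, hr]
      rfl
    rw [h2] at h1
    refine mul_right_cancel₀ ?_ h1
    exact Finset.prod_ne_zero_iff.2 fun v _ => Finset.prod_ne_zero_iff.2 fun c _ =>
      (h c).2.2.2.2.1
  have hZ : ∑ v, (T v).mask + ∑ v, contribution S.grid (T v) v = 0 := by
    have h1 := sum_children X fun v => (T v).total
    rw [(h (root X)).2.2.2.2.2.2.2 rfl, zero_add, Finset.sum_congr rfl
      fun v _ => (h v).2.2.2.2.2.2.1, Finset.sum_add_distrib, Finset.sum_add_distrib] at h1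
    exact add_eq_right.1 h1.symm
  rw [sum_contribution S.grid X T _ _ _ hz hr hτ, hP] at hZ
  rw [eval_testPoly]
  exact hZ

variable [Fintype F] [DecidableEq F] [NeZero m] (P : DistProver n l) (X : Network n)

theorem card_resample_coin {Y : Type} [Fintype Y] (j : Fin n) (get : NodeCoin F m → Y)
    (set : NodeCoin F m → Y → NodeCoin F m) (get_set : ∀ c y, get (set c y) = y)
    (set_get : ∀ c, set c (get c) = c) (set_set : ∀ c y y', set (set c y) y' = set c y')
    (B : Set (JointCoins S.verifier P)) (d : ℕ) (φ : Y → F) (hφ : Function.Injective φ)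
    (hB : ∀ ρ ∈ B, ∃ p : Polynomial F, p ≠ 0 ∧ p.natDegree ≤ d ∧
      ∀ y, (Function.update ρ.1 j (set (ρ.1 j) y), ρ.2) ∈ B → p.eval (φ y) = 0) :
    B.ncard * Fintype.card Y ≤ d * Fintype.card (JointCoins S.verifier P) :=
  card_resample_of_root (fun ρ => get (ρ.1 j))
    (fun ρ y => (Function.update ρ.1 j (set (ρ.1 j) y), ρ.2))
    (fun ρ y => by simp [get_set]) (fun ρ => by simp [set_get]) (fun ρ y y' => by simp [set_set])
    B d φ hφ hB

/-! ### The bad events and their probabilities -/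

/-- The weight base of node `j` makes the sum over its colour vanish. -/
def weightEvent (y : Fin n → F) (j : Fin n) : Set (JointCoins S.verifier P) :=
  {ρ | S.honestSum X (coinWeights ρ.1) (coinMults ρ.1) j y = 0 ∧
    S.honestSum X (coinWeights ρ.1) (coinMults ρ.1) (j + 1) y ≠ 0}

/-- The `j`-th sumcheck polynomial is wrong, but right at the evaluation point. -/
def pointEvent (j : Fin n) : Set (JointCoins S.verifier P) :=
  {ρ | (∃ c, polyEval (sharedCoeff (S.transcript P X ρ) j) c ≠
      S.honestSum X (coinWeights ρ.1) (coinMults ρ.1) (j + 1)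
        (Function.update (S.points ρ.1) j c)) ∧
    polyEval (sharedCoeff (S.transcript P X ρ) j) (S.points ρ.1 j) =
      S.honestSum X (coinWeights ρ.1) (coinMults ρ.1) (j + 1) (S.points ρ.1)}

/-- The global test as a polynomial in the challenge, in an interaction with the prover `P`. -/
def globalTest (ρ : JointCoins S.verifier P) : Polynomial F :=
  testPoly (∑ v, (S.transcript P X ρ v).mask)
    (fun j => ∑ a : Fin k, (ρ.1 j).1 ^ (a : ℕ) *
      polyEval (sharedCoeff (S.transcript P X ρ) j) (S.grid a))
    (fun j => polyEval (sharedCoeff (S.transcript P X ρ) j) (S.points ρ.1 j))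
    (scaledProduct X.graph (coinMults ρ.1) (S.points ρ.1))

/-- The global test fails as an identity, but holds for the challenge. -/
def challengeEvent : Set (JointCoins S.verifier P) :=
  {ρ | S.globalTest P X ρ ≠ 0 ∧ (S.globalTest P X ρ).eval (ρ.1 (root X)).2.2.2 = 0}

/-- As a polynomial in `z j`, the sum has the partial sum at `j + 1` as its coefficient at the
colour `y j`. That coefficient is nonzero in the event and does not involve `z j`. -/
theorem ncard_weightEvent_le (y : Fin n → F) (hy : ∀ i, y i ∈ Set.range S.grid) (j : Fin n) :
    (S.weightEvent P X y j).ncard * Fintype.card F ≤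
      k * Fintype.card (JointCoins S.verifier P) := by
  refine S.card_resample_coin P j (fun c => c.1) (fun c y => (y, c.2)) (fun _ _ => rfl)
    (fun _ => rfl) (fun _ _ _ => rfl) _ k id Function.injective_id ?_
  rintro ρ ⟨-, h⟩
  obtain ⟨a₀, ha₀⟩ := hy j
  let q : Polynomial F := ∑ a : Fin k, .C (S.honestSum X (coinWeights ρ.1) (coinMults ρ.1) (j + 1)
    (Function.update y j (S.grid a))) * .X ^ (a : ℕ)
  refine ⟨q, ?_, ?_, ?_⟩
  · intro hq
    have := congrArg (fun p => Polynomial.coeff p (a₀ : ℕ)) hq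
    simp only [q, Polynomial.finsetSum_coeff, Polynomial.coeff_C_mul, Polynomial.coeff_X_pow,
      Fin.val_inj, mul_ite, mul_one, mul_zero, Finset.sum_ite_eq, Finset.mem_univ, if_true,
      Polynomial.coeff_zero, ha₀, Function.update_eq_self] at this
    exact h this
  · refine Polynomial.natDegree_sum_le_of_forall_le _ _ fun a _ => ?_
    exact (Polynomial.natDegree_C_mul_X_pow_le _ _).trans a.isLt.le
  · rintro w ⟨h0, -⟩
    rw [honestSum, partialSum_succ] at h0
    simp only [q, Polynomial.eval_finsetSum, Polynomial.eval_mul, Polynomial.eval_C,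
      Polynomial.eval_pow, Polynomial.eval_X, id]
    rw [← h0]
    have hm : coinMults (Function.update ρ.1 j (w, (ρ.1 j).2)) = coinMults ρ.1 := by
      funext v; by_cases hv : v = j
      · subst hv; simp [coinMults]
      · simp [coinMults, hv]
    refine Finset.sum_congr rfl fun a _ => ?_
    rw [mul_comm, hm]
    congr 1
    · simp [coinWeights]
    · refine partialSum_congr_weights _ _ _ j.isLt (fun i hi => ?_) _
      have : i ≠ j := fun e => by subst e; omega
      simp [coinWeights, this]

/-- The difference of the announced and the true polynomial is nonzero of degree at most `n`, and
both are fixed before the point of `j` is revealed. -/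
theorem ncard_pointEvent_le (j : Fin n) :
    (S.pointEvent P X j).ncard * m ≤ n * Fintype.card (JointCoins S.verifier P) := by
  have key := S.card_resample_coin P j (fun c => c.2.2.1) (fun c y => (c.1, c.2.1, y, c.2.2.2))
    (fun _ _ => rfl) (fun _ => rfl) (fun _ _ _ => rfl) (S.pointEvent P X j) n (S.point j)
    (fun _ _ h => (S.point_inj h).2) ?_
  · simpa using key
  rintro ρ ⟨⟨c₀, hc₀⟩, -⟩
  have hpoly := S.isPolyFun_honestSum X (coinWeights ρ.1) (coinMults ρ.1) (S.points ρ.1) j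
    (Nat.succ_le_of_lt j.isLt)
  let φ : F → F := fun c => S.honestSum X (coinWeights ρ.1) (coinMults ρ.1) (j + 1)
    (Function.update (S.points ρ.1) j c)
  let q : Polynomial F := ∑ u : Fin n,
    .C (sharedCoeff (S.transcript P X ρ) j u - coeffs n φ u) * .X ^ (u : ℕ)
  have hq : ∀ c, q.eval c = polyEval (sharedCoeff (S.transcript P X ρ) j) c - φ c := by
    intro c
    rw [show φ c = _ from hpoly.eq_sum_coeffs c, polyEval, ← Finset.sum_sub_distrib]
    simp [q, Polynomial.eval_finsetSum, sub_mul, φ]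
  refine ⟨q, ?_, ?_, ?_⟩
  · intro h0
    have := hq c₀
    rw [h0, Polynomial.eval_zero] at this
    exact hc₀ (sub_eq_zero.1 this.symm)
  · refine Polynomial.natDegree_sum_le_of_forall_le _ _ fun u _ => ?_
    exact (Polynomial.natDegree_C_mul_X_pow_le _ _).trans u.isLt.le
  · rintro w ⟨-, h0⟩
    set ρ' : JointCoins S.verifier P :=
      (Function.update ρ.1 j ((ρ.1 j).1, (ρ.1 j).2.1, w, (ρ.1 j).2.2.2), ρ.2) with hρ'
    have hv : ∀ v ≠ j, ρ'.1 v = ρ.1 v := fun v hv => by simp [hρ', hv]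
    have hj : ρ'.1 j = ((ρ.1 j).1, (ρ.1 j).2.1, w, (ρ.1 j).2.2.2) := by simp [hρ']
    have hm : coinMults ρ'.1 = coinMults ρ.1 := by
      funext v; by_cases h : v = j
      · subst h; simp [coinMults, hj]
      · simp [coinMults, hv v h]
    have hz : coinWeights ρ'.1 = coinWeights ρ.1 := by
      funext v; by_cases h : v = j
      · subst h; simp [coinWeights, hj]
      · simp [coinWeights, hv v h]
    have hr : S.points ρ'.1 = Function.update (S.points ρ.1) j (S.point j w) := by
      funext v; by_cases h : v = j
      · subst h; simp [points, hj]
      · simp [points, hv v h, h]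
    -- The first `2 * j + 2` messages contain the node rounds `0, …, j` only, while the resampled
    -- coin is first used in round `j + 1`.
    have hT : sharedCoeff (S.transcript P X ρ') j = sharedCoeff (S.transcript P X ρ) j := by
      have := messageAt_congr S.verifier P X (rounds n) (ρ := ρ') (ρ' := ρ) rfl
        (i := 2 * j + 2) (j := 2 * j + 1) (by omega) fun v L hL => by
          by_cases h : v = j
          · subst h
            have h1 : L.length / 2 ≠ v + 1 := by omega
            have h2 : L.length / 2 ≠ n + 1 := by omega
            simp only [nodeMessage, Network.localInput, hj, h1, h2, false_and, if_false]
          · rw [hv v h]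
      funext u
      simp only [sharedCoeff, transcript, Transcript.unpack, this]
    rw [hT, hr, hm, hz, Function.update_self] at h0
    rw [hq, sub_eq_zero]
    exact h0

/-- Shares and masks are sent by round `n`, before the challenge. The announced product comes later,
but the test polynomial contains the true one instead. -/
theorem ncard_challengeEvent_le :
    (S.challengeEvent P X).ncard * Fintype.card F ≤
      (n + 1) * Fintype.card (JointCoins S.verifier P) := by
  refine S.card_resample_coin P (root X) (fun c => c.2.2.2) (fun c y => (c.1, c.2.1, c.2.2.1, y))
    (fun _ _ => rfl) (fun _ => rfl) (fun _ _ _ => rfl) _ (n + 1) id Function.injective_id ?_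
  rintro ρ ⟨h, -⟩
  refine ⟨S.globalTest P X ρ, h, natDegree_testPoly _ _ _ _, ?_⟩
  rintro w ⟨-, h0⟩
  set ρ' : JointCoins S.verifier P := (Function.update ρ.1 (root X)
    ((ρ.1 (root X)).1, (ρ.1 (root X)).2.1, (ρ.1 (root X)).2.2.1, w), ρ.2) with hρ'
  have hv : ∀ v ≠ root X, ρ'.1 v = ρ.1 v := fun v hv => by simp [hρ', hv]
  have hj : ρ'.1 (root X) = ((ρ.1 (root X)).1, (ρ.1 (root X)).2.1, (ρ.1 (root X)).2.2.1, w) := by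
    simp [hρ']
  have hm : coinMults ρ'.1 = coinMults ρ.1 := by
    funext v; by_cases h : v = root X
    · subst h; simp [coinMults, hj]
    · simp [coinMults, hv v h]
  have hz : ∀ v, (ρ'.1 v).1 = (ρ.1 v).1 := by
    intro v; by_cases h : v = root X
    · subst h; simp [hj]
    · simp [hv v h]
  have hr : S.points ρ'.1 = S.points ρ.1 := by
    funext v; by_cases h : v = root X
    · subst h; simp [points, hj]
    · simp [points, hv v h]
  have hT : ∀ t ≤ n, messageAt S.verifier P X (rounds n) ρ' (2 * t + 1) =
      messageAt S.verifier P X (rounds n) ρ (2 * t + 1) := fun t ht =>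
    messageAt_congr S.verifier P X (rounds n) (ρ := ρ') (ρ' := ρ) rfl
      (i := 2 * n + 2) (j := 2 * t + 1) (by omega) fun v L hL => by
        by_cases h : v = root X
        · subst h
          have h2 : L.length / 2 ≠ n + 1 := by omega
          simp only [nodeMessage, Network.localInput, hj, h2, false_and, if_false]
        · rw [hv v h]
  have hc : sharedCoeff (S.transcript P X ρ') = sharedCoeff (S.transcript P X ρ) := by
    funext j u
    simp only [sharedCoeff, transcript, Transcript.unpack, hT j j.isLt.le]
  have hmask : ∀ v, (S.transcript P X ρ' v).mask = (S.transcript P X ρ v).mask := by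
    intro v
    have := hT 0 (Nat.zero_le _)
    simp only [transcript, Transcript.unpack, this]
  rw [hj] at h0
  rw [← h0]
  simp only [globalTest, hc, hm, hz, hr, hmask, id]

/-- Outside the bad events the test vanishes identically, so every sumcheck equation holds. Downward
induction from the edge product at the points then shows that all announced polynomials are right,
hence that the full sum is zero; downward induction from its value at `y` shows that the full sum is
nonzero. -/
theorem accept_subset (y : Fin n → F) (hy : edgeProduct X.graph y ≠ 0) :
    {ρ : JointCoins S.verifier P | ∀ v, S.verifier.verification.run X.graph
      (stateAfterInteraction S.verifier P X (rounds n) ρ) 1 v = true} ⊆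
    (⋃ j, S.weightEvent P X y j) ∪ (⋃ j, S.pointEvent P X j) ∪ S.challengeEvent P X := by
  intro ρ hρ
  have htest := S.accept_consequences X ρ.1 (S.transcript P X ρ)
    fun v => (S.run_eq_true_iff P X ρ v).1 (hρ v)
  by_contra hbad
  simp only [Set.mem_union, Set.mem_iUnion, not_or, not_exists] at hbad
  obtain ⟨⟨hw, hp⟩, hc⟩ := hbad
  have hzero : S.globalTest P X ρ = 0 := by
    by_contra hne
    exact hc ⟨hne, htest⟩
  set c := sharedCoeff (S.transcript P X ρ)
  set z := coinWeights ρ.1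
  set mu := coinMults ρ.1
  set r := S.points ρ.1
  have hcoeff : ∀ i < n + 1, claim (fun j => polyEval (c j) (r j)) i =
      if h : i < n then ∑ a : Fin k, z ⟨i, h⟩ ^ (a : ℕ) * polyEval (c ⟨i, h⟩) (S.grid a)
      else scaledProduct X.graph mu r := by
    intro i hi
    have := coeff_testPoly (∑ v, (S.transcript P X ρ v).mask)
      (fun j => ∑ a : Fin k, z j ^ (a : ℕ) * polyEval (c j) (S.grid a))
      (fun j => polyEval (c j) (r j)) (scaledProduct X.graph mu r) hi
    have hz := congrArg (fun p => Polynomial.coeff p (i + 1)) hzero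
    exact (sub_eq_zero.1 (this.symm.trans (hz.trans (Polynomial.coeff_zero _)))).symm
  have hclaim : ∀ j ≤ n, claim (fun j => polyEval (c j) (r j)) j = S.honestSum X z mu j r := by
    refine descend ?_ ?_
    · rw [hcoeff n (by omega), dif_neg (lt_irrefl n), honestSum, partialSum_self]
    · intro j hj
      rw [claim, dif_pos j.isLt] at hj
      have hpoly : ∀ x, polyEval (c j) x =
          S.honestSum X z mu (j + 1) (Function.update r j x) := by
        by_contra hne
        push Not at hne
        exact hp j ⟨hne, hj⟩
      rw [hcoeff j (by omega), dif_pos j.isLt, honestSum, partialSum_succ]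
      exact Finset.sum_congr rfl fun a _ => by rw [Fin.eta, hpoly]; rfl
  -- The full sum ignores its base point, so the random points can be traded for the colouring.
  have hsum0 : S.honestSum X z mu 0 y = 0 := by
    rw [honestSum, partialSum_congr (y := r) _ _ _ (Nat.zero_le _) (fun i hi => by omega)]
    exact (hclaim 0 (Nat.zero_le _)).symm
  have hne : ∀ j ≤ n, S.honestSum X z mu j y ≠ 0 := by
    refine descend ?_ ?_
    · rw [honestSum, partialSum_self, scaledProduct]
      exact mul_ne_zero (Finset.prod_ne_zero_iff.2 fun v _ => (ρ.1 v).2.1.ne_zero) hy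
    · intro j hj h0
      exact hw j ⟨h0, hj⟩
  exact hne 0 (Nat.zero_le _) hsum0

theorem soundness (hX : X.graph.Colorable k) (hF : m ≤ Fintype.card F)
    (hm : 3 * (n * k + n * n + (n + 1)) ≤ m) :
    acceptProb S.verifier P X (rounds n) 1 ≤ 1 / 3 := by
  classical
  obtain ⟨col⟩ := hX
  set y : Fin n → F := fun v => S.grid (col v)
  have hy : edgeProduct X.graph y ≠ 0 := (edgeProduct_ne_zero_iff _ _).2 fun u v huv e =>
    col.valid huv (S.grid_inj e)
  set A : Set (JointCoins S.verifier P) := {ρ | ∀ v, S.verifier.verification.run X.graph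
      (stateAfterInteraction S.verifier P X (rounds n) ρ) 1 v = true}
  set N := Fintype.card (JointCoins S.verifier P) with hN
  have hNpos : 0 < N := Fintype.card_pos
  have h1 : A.ncard ≤ ∑ j, (S.weightEvent P X y j).ncard + ∑ j, (S.pointEvent P X j).ncard +
      (S.challengeEvent P X).ncard := by
    refine (Set.ncard_le_ncard (S.accept_subset P X y hy) (Set.toFinite _)).trans ?_
    refine (Set.ncard_union_le _ _).trans (Nat.add_le_add_right ?_ _)
    refine (Set.ncard_union_le _ _).trans (Nat.add_le_add ?_ ?_)
    · simpa using Set.ncard_iUnion_le_of_fintype (S.weightEvent P X y)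
    · simpa using Set.ncard_iUnion_le_of_fintype (S.pointEvent P X)
  have h2 : A.ncard * m ≤ (n * k + n * n + (n + 1)) * N := by
    refine (Nat.mul_le_mul_right m h1).trans ?_
    rw [add_mul, add_mul, add_mul _ (n + 1), add_mul (n * k), Finset.sum_mul, Finset.sum_mul]
    refine Nat.add_le_add (Nat.add_le_add ?_ ?_) ?_
    · refine (Finset.sum_le_sum fun j _ => (Nat.mul_le_mul_left _ hF).trans
        (S.ncard_weightEvent_le P X y (fun i => ⟨_, rfl⟩) j)).trans ?_
      simp [mul_assoc, hN]
    · refine (Finset.sum_le_sum fun j _ => S.ncard_pointEvent_le P X j).trans ?_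
      simp [mul_assoc, hN]
    · exact (Nat.mul_le_mul_left _ hF).trans (S.ncard_challengeEvent_le P X)
  have h3 : 3 * A.ncard ≤ N := by
    have hmpos : 0 < m := NeZero.pos m
    refine Nat.le_of_mul_le_mul_right ?_ hmpos
    calc 3 * A.ncard * m = 3 * (A.ncard * m) := by ring
      _ ≤ 3 * ((n * k + n * n + (n + 1)) * N) := Nat.mul_le_mul_left _ h2
      _ = 3 * (n * k + n * n + (n + 1)) * N := by ring
      _ ≤ m * N := Nat.mul_le_mul_right _ hm
      _ = N * m := mul_comm _ _
  rw [acceptProb, PMF.toOuterMeasure_uniformOfFintype_apply]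
  rw [ENNReal.toReal_div, ENNReal.toReal_natCast, ENNReal.toReal_natCast, div_le_iff₀ (by positivity)]
  have h4 : (3 : ℝ) * A.ncard ≤ N := by exact_mod_cast h3
  rw [← Nat.card_eq_fintype_card, Nat.card_coe_set_eq]
  linarith

end Setup

namespace Setup

/-! ### The honest prover -/

variable {F : Type} [Field F] {n m k l b : ℕ} (S : Setup F n m k l b)

/-- The coins of the honest prover: the pads of the shares and the masks of the totals. -/
abbrev ProverCoin (F : Type) (n : ℕ) : Type := (Fin n → Fin n → F) × (Fin n → F)

/-- The mask of the total of a node; that of the root is zero. -/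
def totalMask (y : Fin n → F) (v : Fin n) : F := if v.val = 0 then 0 else y v

/-- The coefficients of the `j`-th sumcheck polynomial. -/
def honestCoeff (X : Network n) (z mult r : Fin n → F) (j : Fin n) : Fin n → F :=
  coeffs n fun c => S.honestSum X z mult (j + 1) (Function.update r j c)

/-- The product over the subtree of `v` of the multipliers and vertex factors. -/
def subtreeProduct (X : Network n) (mult r : Fin n → F) (v : Fin n) : F :=
  ∏ u ∈ subtree X v, (mult u * vertexFactor (fun w => X.graph.Adj w u) r u)

/-- The transcript of `v` in an interaction with the honest prover, except for the total. -/
def honestBase (X : Network n) (p : ProverCoin F n) (z mult r : Fin n → F) (τ : F) (v : Fin n) :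
    Transcript F n where
  shareLeft j := S.honestCoeff X z mult r j v + p.1 j v
  shareRight j := - p.1 j (finRotate n v)
  weights := z
  points := r
  -- These differences telescope: over a subtree they add up to the `totalMask` of its top node, and
  -- over the whole tree to zero.
  mask := totalMask p.2 v - ∑ c ∈ children X v, totalMask p.2 c
  product := subtreeProduct X mult r v
  total := 0
  challenge := τ

/-- The transcript of `v` in an interaction with the honest prover. -/
def honestTranscript (X : Network n) (p : ProverCoin F n) (z mult r : Fin n → F) (τ : F)
    (v : Fin n) : Transcript F n :=
  { S.honestBase X p z mult r τ v with
    total := totalMask p.2 v +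
      ∑ u ∈ subtree X v, contribution S.grid (S.honestBase X p z mult r τ u) u }

/-- This lets the prover send the `j`-th polynomial before the point of `j` and later ones are
known. -/
theorem honestCoeff_congr (X : Network n) (z mult : Fin n → F) {r r' : Fin n → F} (j : Fin n)
    (h : ∀ i < j, r i = r' i) : S.honestCoeff X z mult r j = S.honestCoeff X z mult r' j := by
  unfold honestCoeff
  congr 1
  funext c
  refine partialSum_congr _ _ _ (Nat.succ_le_of_lt j.isLt) fun i hi => ?_
  by_cases hij : i = j
  · subst hij; simp
  · rw [Function.update_of_ne hij, Function.update_of_ne hij]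
    exact h i (lt_of_le_of_ne (Fin.le_def.2 (by omega)) hij)

theorem polyEval_honestCoeff (X : Network n) (z mult r : Fin n → F) (j : Fin n) (c : F) :
    polyEval (S.honestCoeff X z mult r j) c =
      S.honestSum X z mult (j + 1) (Function.update r j c) :=
  ((S.isPolyFun_honestSum X z mult r j (Nat.succ_le_of_lt j.isLt)).eq_sum_coeffs c).symm

theorem pack_honestTranscript_congr (X : Network n) (p : ProverCoin F n) (z mult : Fin n → F)
    {r r' : Fin n → F} {τ τ' : F} {t : ℕ} (ht : t ≤ n + 1)
    (hr : ∀ i : Fin n, (i : ℕ) < t → r i = r' i) (hτ : t = n + 1 → τ = τ') (v : Fin n) :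
    (S.honestTranscript X p z mult r τ v).pack t = (S.honestTranscript X p z mult r' τ' v).pack t := by
  by_cases htn : t = n + 1
  · rw [hτ htn, show r = r' from funext fun i => hr i (by omega)]
  · have h1 : t ≠ 0 → t - 1 < n := fun _ => by omega
    have h2 : ¬ t < n → t = n := fun _ => by omega
    simp only [Transcript.pack, honestTranscript, honestBase]
    congr 1
    · split_ifs with h
      · rw [S.honestCoeff_congr X z mult ⟨t, h⟩ fun i hi => hr i hi]
      · rfl
      · exact absurd (h2 h) ‹_›
    · congr 1
      · split_ifs with h
        · rfl
        · rfl
        · exact absurd (h2 h) ‹_›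
      · congr 1
        · split_ifs with h h'
          · rfl
          · rfl
          · exact absurd (h1 h) h'
        · congr 1
          split_ifs with h h'
          · rfl
          · exact hr _ (by simp only; omega)
          · rfl

/-- The honest prover. -/
abbrev honestProver [Fintype F] (X : Network n) : DistProver n l where
  Coin := ProverCoin F n
  -- Points and challenge not yet revealed are read as arbitrary defaults;
  -- `pack_honestTranscript_congr` shows that the current message does not depend on them.
  message p L v := S.enc ((S.honestTranscript X p
    (fun u => S.dec (L.getD 0 default u) 0) (fun u => S.dec (L.getD 0 default u) 1)
    (fun u => S.dec (L.getD (2 * (u + 1)) default u) 0)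
    (S.dec (L.getD (2 * (n + 1)) default (root X)) 0) v).pack (L.length / 2))

section Execution

variable [Fintype F] [DecidableEq F] [NeZero m] (X : Network n)

theorem messageAt_even (P : DistProver n l) (ρ : JointCoins S.verifier P) {t : ℕ} (ht : t ≤ n + 1)
    (v : Fin n) : messageAt S.verifier P X (rounds n) ρ (2 * t) v =
      S.enc (S.nodeMessage v (ρ.1 v) t) := by
  have h : ¬ Odd (rounds n - 2 * t) := by
    rw [Nat.not_odd_iff_even]; exact ⟨n + 2 - t, by simp only [rounds]; omega⟩
  rw [messageAt, if_neg h]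
  simp only [List.length_map, length_conversation, Network.localInput]
  rw [Nat.mul_div_cancel_left _ two_pos]

/-- The transcript of `v` in the interaction with the honest prover, as a function of all coins. -/
def honestView (X : Network n) (ρ : (Fin n → NodeCoin F m) × ProverCoin F n) (v : Fin n) :
    Transcript F n :=
  S.honestTranscript X ρ.2 (coinWeights ρ.1) (coinMults ρ.1) (S.points ρ.1)
    (ρ.1 (root X)).2.2.2 v

theorem messageAt_odd (ρ : JointCoins S.verifier (S.honestProver X)) {t : ℕ} (ht : t ≤ n + 1)
    (v : Fin n) : messageAt S.verifier (S.honestProver X) X (rounds n) ρ (2 * t + 1) v =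
      S.enc ((S.honestView X ρ v).pack t) := by
  have h : Odd (rounds n - (2 * t + 1)) := ⟨n + 1 - t, by simp only [rounds]; omega⟩
  have hget : ∀ {i : ℕ}, i ≤ t → ∀ u,
      (conversation S.verifier (S.honestProver X) X (rounds n) ρ (2 * t + 1)).getD (2 * i)
        default u = S.enc (S.nodeMessage u (ρ.1 u) i) := fun {i} hi u => by
    rw [getD_conversation _ _ _ _ _ (by omega), S.messageAt_even X _ _ (by omega)]
  rw [messageAt, if_pos h]
  simp only
  rw [length_conversation, show (2 * t + 1) / 2 = t by omega]
  congr 1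
  have hz : (fun u => S.dec ((conversation S.verifier (S.honestProver X) X (rounds n) ρ
      (2 * t + 1)).getD 0 default u) 0) = coinWeights ρ.1 := funext fun u => by
    rw [show 0 = 2 * 0 from rfl, hget (Nat.zero_le _), S.dec_enc]
    simp [nodeMessage, coinWeights]
  have hm : (fun u => S.dec ((conversation S.verifier (S.honestProver X) X (rounds n) ρ
      (2 * t + 1)).getD 0 default u) 1) = coinMults ρ.1 := funext fun u => by
    rw [show 0 = 2 * 0 from rfl, hget (Nat.zero_le _), S.dec_enc]
    simp [nodeMessage, coinMults]
  rw [hz, hm]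
  refine S.pack_honestTranscript_congr X _ _ _ ht (fun i hi => ?_) (fun htn => ?_) v
  · rw [hget (by omega), S.dec_enc]
    simp [nodeMessage, points]
  · rw [hget htn.ge, S.dec_enc]
    have h0 : (root X).val = 0 := rfl
    have : n ≠ 0 := X.connected.nonempty.some.pos.ne'
    simp [nodeMessage, h0, this]

theorem transcript_honestProver (ρ : JointCoins S.verifier (S.honestProver X)) (v : Fin n) :
    S.transcript (S.honestProver X) X ρ v = S.honestView X ρ v := by
  rw [transcript, ← Transcript.unpack_pack (S.honestView X ρ v)]
  refine Transcript.unpack_congr fun t ht => ?_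
  rw [S.messageAt_odd X ρ ht, S.dec_enc]

end Execution

/-! ### Completeness -/

/-- The pads cancel between left and right shares, and with honest polynomials the test telescopes
to `τ` times the full sum. That sum is zero because a grid point with nonzero edge product would be
a proper colouring. -/
theorem sum_contribution_honest (X : Network n) (hX : ¬ X.graph.Colorable k) (p : ProverCoin F n)
    (z mult r : Fin n → F) (τ : F) :
    ∑ v, contribution S.grid (S.honestBase X p z mult r τ v) v = 0 := by
  rw [sum_contribution S.grid X _ z r τ (fun _ => rfl) (fun _ => rfl) (fun _ => rfl)]
  have hc : ∀ j, sharedCoeff (S.honestBase X p z mult r τ) j = S.honestCoeff X z mult r j := by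
    intro j
    funext u
    simp only [sharedCoeff, honestBase, Equiv.apply_symm_apply]
    ring
  have hstep : ∀ j : Fin n, (τ ^ (j + 1 : ℕ) * ∑ a : Fin k, z j ^ (a : ℕ) *
        polyEval (sharedCoeff (S.honestBase X p z mult r τ) j) (S.grid a) -
      τ ^ (j + 2 : ℕ) * polyEval (sharedCoeff (S.honestBase X p z mult r τ) j) (r j)) =
      τ ^ (j + 1 : ℕ) * S.honestSum X z mult j r -
        τ ^ (j + 1 + 1 : ℕ) * S.honestSum X z mult (j + 1) r := by
    intro j
    simp only [hc, polyEval_honestCoeff, Function.update_eq_self]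
    rw [show S.honestSum X z mult j r = _ from partialSum_succ _ _ _ j r]
    rfl
  have hprod : (S.honestBase X p z mult r τ (root X)).product = S.honestSum X z mult n r := by
    rw [honestSum, partialSum_self]
    simp only [honestBase, subtreeProduct, subtree_root, scaledProduct, edgeProduct,
      Finset.prod_mul_distrib]
  have hzero : S.honestSum X z mult 0 r = 0 := by
    refine partialSum_eq_zero _ _ _ (Nat.zero_le _) (fun x hx => ?_) _ (fun i hi => by omega)
    rw [scaledProduct, mul_eq_zero]
    right
    by_contra hne
    choose col hcol using hx
    refine hX ⟨SimpleGraph.Coloring.mk col fun {u v} huv e => ?_⟩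
    exact (edgeProduct_ne_zero_iff _ _).1 hne u v huv (by rw [← hcol, ← hcol, e])
  rw [Finset.sum_congr rfl fun j _ => hstep j, hprod,
    ← Finset.sum_range (fun j => τ ^ (j + 1) * S.honestSum X z mult j r -
        τ ^ (j + 1 + 1) * S.honestSum X z mult (j + 1) r),
    Finset.sum_range_sub' fun j => τ ^ (j + 1) * S.honestSum X z mult j r, hzero]
  ring

theorem subtreeProduct_eq (X : Network n) (mult r : Fin n → F) (v : Fin n) :
    subtreeProduct X mult r v = mult v * vertexFactor (fun u => X.graph.Adj u v) r v *
      ∏ c ∈ children X v, subtreeProduct X mult r c :=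
  prod_subtree X _ v

theorem total_honestTranscript (X : Network n) (p : ProverCoin F n) (z mult r : Fin n → F) (τ : F)
    (v : Fin n) :
    (S.honestTranscript X p z mult r τ v).total = (S.honestTranscript X p z mult r τ v).mask +
      contribution S.grid (S.honestTranscript X p z mult r τ v) v +
      ∑ c ∈ children X v, (S.honestTranscript X p z mult r τ c).total := by
  simp only [honestTranscript]
  rw [sum_subtree, Finset.sum_add_distrib]
  simp only [honestBase, contribution]
  ring

theorem total_honestTranscript_root (X : Network n) (hX : ¬ X.graph.Colorable k)
    (p : ProverCoin F n) (z mult r : Fin n → F) (τ : F) :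
    (S.honestTranscript X p z mult r τ (root X)).total = 0 := by
  simp only [honestTranscript, subtree_root, S.sum_contribution_honest X hX]
  simp [totalMask, root]

theorem subtreeProduct_ne_zero (X : Network n) (ω : Fin n → NodeCoin F m) (v : Fin n) :
    subtreeProduct X (coinMults ω) (S.points ω) v ≠ 0 :=
  Finset.prod_ne_zero_iff.2 fun u _ =>
    mul_ne_zero (ω u).2.1.ne_zero (vertexFactor_ne_zero _ (S.points_injective ω) u)

theorem accepts_honestView (X : Network n) (hX : ¬ X.graph.Colorable k)
    (ρ : (Fin n → NodeCoin F m) × ProverCoin F n) (v : Fin n) :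
    S.Accepts v (ρ.1 v) (S.honestView X ρ v) (inbox X (S.honestView X ρ) v) := by
  rw [accepts_inbox_iff]
  refine ⟨fun u _ => ⟨rfl, rfl, rfl⟩, rfl, rfl, fun hv => ?_, S.subtreeProduct_ne_zero X ρ.1 v,
    subtreeProduct_eq X _ _ v, S.total_honestTranscript X _ _ _ _ _ v, fun hv => ?_⟩
  · rw [(eq_root_iff X).2 hv]; rfl
  · rw [(eq_root_iff X).2 hv]
    exact S.total_honestTranscript_root X hX _ _ _ _ _

theorem completeness [Fintype F] [DecidableEq F] [NeZero m] (X : Network n)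
    (hX : ¬ X.graph.Colorable k) :
    acceptProb S.verifier (S.honestProver X) X (rounds n) 1 = 1 := by
  have : {ρ : JointCoins S.verifier (S.honestProver X) | ∀ v, S.verifier.verification.run X.graph
      (stateAfterInteraction S.verifier (S.honestProver X) X (rounds n) ρ) 1 v = true} =
      Set.univ := by
    refine Set.eq_univ_of_forall fun ρ v => ?_
    rw [run_eq_true_iff, show S.transcript (S.honestProver X) X ρ = S.honestView X ρ from
      funext (S.transcript_honestProver X ρ)]
    exact S.accepts_honestView X hX ρ v
  rw [acceptProb, this, (PMF.toOuterMeasure_apply_eq_one_iff _ _).2 (Set.subset_univ _)]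
  rfl

end Setup

/-! ### Zero knowledge -/

theorem map_uniformOfFintype_of_bijective {α β : Type} [Fintype α] [Nonempty α] [Fintype β]
    [Nonempty β] {f : α → β} (hf : Function.Bijective f) :
    (PMF.uniformOfFintype α).map f = PMF.uniformOfFintype β := by
  classical
  ext x
  obtain ⟨a, rfl⟩ := hf.2 x
  rw [PMF.map_apply, tsum_eq_single a]
  · simp [Fintype.card_of_bijective hf]
  · intro a' ha'
    rw [if_neg fun e => ha' (hf.1 e).symm]

theorem map_fst_uniformOfFintype {α β : Type} [Fintype α] [Nonempty α] [Fintype β] [Nonempty β] :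
    (PMF.uniformOfFintype (α × β)).map Prod.fst = PMF.uniformOfFintype α := by
  classical
  ext x
  rw [PMF.map_apply, tsum_fintype, Fintype.sum_prod_type]
  simp only [PMF.uniformOfFintype_apply, Fintype.card_prod]
  rw [Finset.sum_eq_single x]
  · simp only [if_true, Finset.sum_const, Finset.card_univ, nsmul_eq_mul, Nat.cast_mul]
    rw [ENNReal.mul_inv (by simp) (by simp), mul_left_comm, ENNReal.mul_inv_cancel (by simp)
      (by simp), mul_one]
  · intro y _ hy
    simp [hy.symm]
  · simp

theorem map_eval_uniformOfFintype {ι α : Type} [Fintype ι] [DecidableEq ι] [Fintype α] [Nonempty α]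
    (i : ι) : (PMF.uniformOfFintype (ι → α)).map (fun f => f i) = PMF.uniformOfFintype α := by
  have h := map_uniformOfFintype_of_bijective (Equiv.funSplitAt i α).bijective
  rw [← map_fst_uniformOfFintype (α := α) (β := {j // j ≠ i} → α), ← h, PMF.map_comp]
  rfl

theorem tvDist_self {α : Type} (p : PMF α) : tvDist p p = 0 := by simp [tvDist]

/-- The two shares held by one node belong to different coefficients, so their pads are independent.
-/
theorem finRotate_ne_self {n : ℕ} (hn : 2 ≤ n) (v : Fin n) : finRotate n v ≠ v := by
  obtain ⟨n, rfl⟩ := Nat.exists_eq_add_of_le' hn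
  rw [finRotate_apply]
  simp

namespace Setup

variable {F : Type} [Field F] {n m k l b : ℕ} (S : Setup F n m k l b)

/-- All coins of an interaction with the honest prover. A node of the simulator draws coins of the
same shape, and reads the multipliers as products of subtrees, the pads as shares, and the masks as
totals of subtrees. -/
abbrev AllCoins (F : Type) [Field F] (n m : ℕ) : Type := (Fin n → NodeCoin F m) × ProverCoin F n

/-- The simulated transcript of `v`, except for the mask. -/
def simBase (ξ : AllCoins F n m) (v : Fin n) : Transcript F n where
  shareLeft j := ξ.2.1 j v
  shareRight j := - ξ.2.1 j (finRotate n v)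
  weights := coinWeights ξ.1
  points := S.points ξ.1
  mask := 0
  product := (ξ.1 v).2.1
  total := totalMask ξ.2.2 v
  challenge := (ξ.1 ⟨0, v.pos⟩).2.2.2

/-- The simulated transcript of a node `v` with set of children `K`. -/
def simTranscript (ξ : AllCoins F n m) (K : Finset (Fin n)) (v : Fin n) : Transcript F n :=
  { S.simBase ξ v with
    mask := totalMask ξ.2.2 v - contribution S.grid (S.simBase ξ v) v -
      ∑ c ∈ K, totalMask ξ.2.2 c }

/-- The simulated coins of a node `v` with set of neighbours `N` and set of children `K`. -/
def simCoin (ξ : AllCoins F n m) (N : Fin n → Prop) (K : Finset (Fin n)) (v : Fin n) :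
    NodeCoin F m :=
  ((ξ.1 v).1,
    (ξ.1 v).2.1 * (Units.mk0 _ (vertexFactor_ne_zero N (S.points_injective ξ.1) v) *
      ∏ c ∈ K, (ξ.1 c).2.1)⁻¹,
    (ξ.1 v).2.2.1, (ξ.1 v).2.2.2)

open Classical in
/-- The simulated messages of the neighbours of a node `v`. -/
def simInbox (ξ : AllCoins F n m) (N : Fin n → Prop) (K : Finset (Fin n)) (v u : Fin n) :
    Option (EdgeMessage F n) :=
  if N u then some (coinWeights ξ.1, S.points ξ.1, (ξ.1 ⟨0, v.pos⟩).2.2.2,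
    if u ∈ K then ((ξ.1 u).2.1 : F) else 1, if u ∈ K then totalMask ξ.2.2 u else 0)
  else none

/-- The coins with which the simulator at `v` produces the view of `v` in the interaction with
coins `ρ`. -/
def simulatedCoins (X : Network n) (v : Fin n) (ρ : AllCoins F n m) : AllCoins F n m :=
  (fun u => ((ρ.1 u).1, Units.mk0 _ (S.subtreeProduct_ne_zero X ρ.1 u), (ρ.1 u).2.2.1,
      (ρ.1 u).2.2.2),
    fun j u => ρ.2.1 j u +
      if u = v then S.honestCoeff X (coinWeights ρ.1) (coinMults ρ.1) (S.points ρ.1) j v else 0,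
    fun u => if u.val = 0 then ρ.2.2 u else (S.honestView X ρ u).total)

/-- The map is triangular. Weights, points and challenges are unchanged; a multiplier is recovered
by dividing a subtree product by those of the children and the vertex factor; then pads differ by a
known shift, and masks by known contributions. -/
theorem simulatedCoins_injective (X : Network n) (v : Fin n) : Function.Injective (S.simulatedCoins X v) := by
  intro ρ ρ' h
  simp only [simulatedCoins, Prod.mk.injEq] at h
  obtain ⟨h1, h2, h3⟩ := h
  have h1' := fun u => congrFun h1 u
  simp only [Prod.mk.injEq, Units.mk0_inj] at h1'
  have hr : S.points ρ.1 = S.points ρ'.1 := funext fun u => by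
    simp only [points, (h1' u).2.2.1]
  have hm : ∀ u, (ρ.1 u).2.1 = (ρ'.1 u).2.1 := fun u => by
    have e := (h1' u).2.1
    have hc : ∏ c ∈ children X u, subtreeProduct X (coinMults ρ.1) (S.points ρ.1) c =
        ∏ c ∈ children X u, subtreeProduct X (coinMults ρ'.1) (S.points ρ'.1) c :=
      Finset.prod_congr rfl fun c _ => (h1' c).2.1
    rw [subtreeProduct_eq, subtreeProduct_eq, hc, hr] at e
    exact Units.ext (mul_right_cancel₀ (vertexFactor_ne_zero _ (S.points_injective ρ'.1) u)
      (mul_right_cancel₀ (Finset.prod_ne_zero_iff.2 fun c _ =>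
        S.subtreeProduct_ne_zero X ρ'.1 c) e))
  have hω : ρ.1 = ρ'.1 := funext fun u =>
    Prod.ext (h1' u).1 (Prod.ext (hm u) (Prod.ext (h1' u).2.2.1 (h1' u).2.2.2))
  have hs : ρ.2.1 = ρ'.2.1 := funext fun j => funext fun u => by
    have := congrFun (congrFun h2 j) u
    rw [hω] at this
    exact add_right_cancel this
  have hy : ρ.2.2 = ρ'.2.2 := funext fun u => by
    have := congrFun h3 u
    by_cases hu : u.val = 0
    · simpa [hu] using this
    · simp only [hu, if_false, honestView, honestTranscript] at this
      have hc : ∀ w, contribution S.grid (S.honestBase X ρ.2 (coinWeights ρ.1) (coinMults ρ.1)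
          (S.points ρ.1) (ρ.1 (root X)).2.2.2 w) w =
          contribution S.grid (S.honestBase X ρ'.2 (coinWeights ρ'.1) (coinMults ρ'.1)
          (S.points ρ'.1) (ρ'.1 (root X)).2.2.2 w) w := fun w => by
        simp only [contribution, honestBase, hω, hs]
      simp only [hc] at this
      simpa [totalMask, hu] using this
  exact Prod.ext hω (Prod.ext hs hy)

theorem totalMask_simulatedCoins {X : Network n} (hX : ¬ X.graph.Colorable k) (v : Fin n)
    (ρ : AllCoins F n m) (u : Fin n) : totalMask (S.simulatedCoins X v ρ).2.2 u = (S.honestView X ρ u).total := by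
  by_cases hu : u.val = 0
  · rw [totalMask, if_pos hu, (eq_root_iff X).2 hu]
    exact (S.total_honestTranscript_root X hX _ _ _ _ _).symm
  · simp [totalMask, simulatedCoins, hu]

variable [Fintype F] [DecidableEq F] [NeZero m]

/-- The view that consists of given coins, transcript and messages of neighbours. -/
def viewOf (v : Fin n) (c : NodeCoin F m) (T : Transcript F n)
    (I : Fin n → Option (EdgeMessage F n)) : NodeView S.verifier :=
  (c, (List.range (rounds n)).map fun i =>
      S.enc (if Even i then S.nodeMessage v c (i / 2) else T.pack (i / 2)),
    [fun u => (I u).map S.encEdge])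

open Classical in
/-- The simulator: every node tells its neighbours whether they are its parent, and then outputs a
view that it makes up on its own. -/
abbrev simulator : Simulator S.verifier where
  Coin := AllCoins F n m
  algorithm :=
    { send := fun s _ v => S.encEdge (0, 0, 0, if s.1.parent = v then 1 else 0, 0)
      output := fun s I =>
        let J : Fin n → Option (EdgeMessage F n) :=
          fun u => (I.headD (fun _ => none) u).map S.decEdge
        let N : Fin n → Prop := fun u => (J u).isSome
        -- The product slot holds `1` if the sender names the receiver as its parent and `0`
        -- otherwise, so this is the set of children.
        let K : Finset (Fin n) := {u | ∃ M ∈ J u, M.2.2.2.1 = 1}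
        S.viewOf s.1.id (S.simCoin s.2 N K s.1.id) (S.simTranscript s.2 K s.1.id)
          (S.simInbox s.2 N K s.1.id) }

variable (X : Network n)

theorem run_simulator (ξ : Fin n → AllCoins F n m) (v : Fin n) :
    S.simulator.algorithm.run X.graph (fun u => (X.localInput u, ξ u)) 1 v =
      S.viewOf v (S.simCoin (ξ v) (fun u => X.graph.Adj u v) (children X v) v)
        (S.simTranscript (ξ v) (children X v) v)
        (S.simInbox (ξ v) (fun u => X.graph.Adj u v) (children X v) v) := by
  classical
  set J : Fin n → Option (EdgeMessage F n) := fun u =>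
    (if X.graph.Adj u v then some (S.encEdge (0, 0, 0, if X.parent u = v then 1 else 0, 0))
      else none).map S.decEdge with hJ
  have hN : (fun u => ((J u).isSome : Prop)) = fun u => X.graph.Adj u v := by
    funext u
    by_cases h : X.graph.Adj u v <;> simp [hJ, h]
  have hK : (Finset.univ.filter fun u => ∃ M ∈ J u, M.2.2.2.1 = 1) = children X v := by
    ext u
    by_cases h : X.graph.Adj u v <;> simp [hJ, h, children, S.decEdge_encEdge]
  rw [← hN, ← hK]
  simp only [DistAlgorithm.run, DistAlgorithm.received, List.nil_append, List.headD_cons,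
    Network.localInput, hJ]
  congr!

theorem view_honestProver (ρ : JointCoins S.verifier (S.honestProver X)) (v : Fin n) :
    (ρ.1 v, (conversation S.verifier (S.honestProver X) X (rounds n) ρ (rounds n)).map (· v),
      S.verifier.verification.received X.graph
        (stateAfterInteraction S.verifier (S.honestProver X) X (rounds n) ρ) 1 v) =
    S.viewOf v (ρ.1 v) (S.honestView X ρ v) (inbox X (S.honestView X ρ) v) := by
  rw [received_eq, show S.transcript (S.honestProver X) X ρ = S.honestView X ρ from
      funext (S.transcript_honestProver X ρ), viewOf, conversation_eq_map, List.map_map]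
  congr 2
  refine List.map_congr_left fun i hi => ?_
  rw [List.mem_range] at hi
  simp only [rounds] at hi
  rcases Nat.even_or_odd' i with ⟨t, rfl | rfl⟩
  · rw [if_pos (even_two_mul t), Nat.mul_div_cancel_left _ two_pos]
    exact S.messageAt_even X _ ρ (by omega) v
  · rw [if_neg (by simp), show (2 * t + 1) / 2 = t by omega]
    exact S.messageAt_odd X ρ (by omega) v

variable {X}

/-- The simulator solves the local product equation for the multiplier and the local total equation
for the mask. The honest transcript satisfies both equations, so equal shares, products and totals
force equal views. -/
theorem viewOf_simulatedCoins (hn : 2 ≤ n) (hX : ¬ X.graph.Colorable k) (v : Fin n)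
    (ρ : AllCoins F n m) :
    S.viewOf v (S.simCoin (S.simulatedCoins X v ρ) (fun u => X.graph.Adj u v) (children X v) v)
        (S.simTranscript (S.simulatedCoins X v ρ) (children X v) v)
        (S.simInbox (S.simulatedCoins X v ρ) (fun u => X.graph.Adj u v) (children X v) v) =
      S.viewOf v (ρ.1 v) (S.honestView X ρ v) (inbox X (S.honestView X ρ) v) := by
  classical
  have hZ := S.totalMask_simulatedCoins hX v ρ
  have hP : ∀ u, (((S.simulatedCoins X v ρ).1 u).2.1 : F) = (S.honestView X ρ u).product :=
    fun _ => rfl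
  have hbase : S.simBase (S.simulatedCoins X v ρ) v = { S.honestView X ρ v with mask := 0 } := by
    ext j
    · simp [simBase, simulatedCoins, honestView, honestTranscript, honestBase, add_comm]
    -- The pad is shifted only at `v`, so the right share, padded at `finRotate n v`, is untouched.
    · simp only [simBase, simulatedCoins, honestView, honestTranscript, honestBase,
        finRotate_ne_self hn v, if_false, add_zero]
    · rfl
    · rfl
    · rfl
    · rfl
    · exact hZ v
    · rfl
  congr 1
  · refine Prod.ext rfl (Prod.ext ?_ rfl)
    refine Units.ext ?_
    have hu := subtreeProduct_eq X (coinMults ρ.1) (S.points ρ.1) v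
    simp only [simCoin]
    rw [← div_eq_mul_inv, Units.val_div_eq_div_val, Units.val_mul, Units.coe_prod, Units.val_mk0]
    refine (div_eq_iff ?_).2 ?_
    · exact mul_ne_zero (vertexFactor_ne_zero _ (S.points_injective _) v)
        (Finset.prod_ne_zero_iff.2 fun c _ => Units.ne_zero _)
    · rw [← mul_assoc]
      exact hu
  · have hmask : totalMask (S.simulatedCoins X v ρ).2.2 v -
        contribution S.grid (S.simBase (S.simulatedCoins X v ρ) v) v -
        ∑ c ∈ children X v, totalMask (S.simulatedCoins X v ρ).2.2 c =
        (S.honestView X ρ v).mask := by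
      simp only [hZ]
      rw [show (S.honestView X ρ v).total = _ from S.total_honestTranscript X _ _ _ _ _ v, hbase]
      simp only [honestView, contribution]
      ring
    rw [simTranscript, hmask, hbase]
  · funext u
    simp only [simInbox, inbox, edgeMessage, hZ, hP]
    by_cases h : X.graph.Adj u v
    · simp only [h, if_true, children, Finset.mem_filter, Finset.mem_univ, true_and]
      rfl
    · simp only [h, if_false]

/-- The output at `v` uses only the coins of `v`, and an injection of a finite set into itself
preserves the uniform distribution. -/
theorem simDist_eq_viewDist (hn : 2 ≤ n) (hX : ¬ X.graph.Colorable k) (v : Fin n) :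
    simDist S.simulator X 1 v = viewDist S.verifier (S.honestProver X) X (rounds n) 1 v := by
  let Φ : AllCoins F n m → NodeView S.verifier := fun ξ =>
    S.viewOf v (S.simCoin ξ (fun u => X.graph.Adj u v) (children X v) v)
      (S.simTranscript ξ (children X v) v)
      (S.simInbox ξ (fun u => X.graph.Adj u v) (children X v) v)
  have h1 : simDist S.simulator X 1 v = (PMF.uniformOfFintype (AllCoins F n m)).map Φ := by
    rw [← map_eval_uniformOfFintype (ι := Fin n) v, PMF.map_comp]
    exact congrArg (PMF.map · _) (funext fun ξ => S.run_simulator X ξ v)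
  have h2 : viewDist S.verifier (S.honestProver X) X (rounds n) 1 v =
      (PMF.uniformOfFintype (AllCoins F n m)).map (Φ ∘ S.simulatedCoins X v) :=
    congrArg (PMF.map · _) (funext fun ρ => (S.view_honestProver X ρ v).trans
      (S.viewOf_simulatedCoins hn hX v ρ).symm)
  rw [h1, h2, ← PMF.map_comp, map_uniformOfFintype_of_bijective
    (Finite.injective_iff_bijective.1 (S.simulatedCoins_injective X v))]

end Setup

/-! ### Choice of the parameters -/

theorem exists_coding {α : Type} [Fintype α] [Nonempty α] {b : ℕ} (h : Fintype.card α ≤ 2 ^ b) :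
    ∃ (enc : α → BitString b) (dec : BitString b → α), ∀ a, dec (enc a) = a := by
  obtain ⟨e⟩ := Function.Embedding.nonempty_of_card_le (α := α) (β := BitString b) (by simpa using h)
  exact ⟨e, Function.invFun e, Function.leftInverse_invFun e.injective⟩

theorem card_pow_le_two_pow_clog (q a : ℕ) : q ^ a ≤ 2 ^ (a * Nat.clog 2 q) := by
  rw [mul_comm, pow_mul]
  exact Nat.pow_le_pow_left (Nat.le_pow_clog one_lt_two q) a

/-- The number of evaluation points of each node. -/
def numPoints (k n : ℕ) : ℕ := 3 * (n * k + n * n + (n + 1))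

instance (k n : ℕ) : NeZero (numPoints k n) := ⟨by simp [numPoints]⟩

/-- Node `v` chooses from the `v`-th block of `numPoints k n` consecutive integers, and colours are
`0, …, k - 1`; the bound on `q` keeps all of them distinct modulo `q`. The message lengths count 4
and `2 * n + 3` field elements. -/
theorem exists_setup (n k q : ℕ) [Fact q.Prime] (hq : (n + 1) * numPoints k n + k ≤ q) :
    Nonempty (Setup (ZMod q) n (numPoints k n) k (4 * Nat.clog 2 q)
      ((2 * n + 3) * Nat.clog 2 q)) := by
  have hcast : ∀ a b : ℕ, a < q → b < q → (a : ZMod q) = b → a = b := fun a b ha hb h => by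
    have := congrArg ZMod.val h
    rwa [ZMod.val_natCast_of_lt ha, ZMod.val_natCast_of_lt hb] at this
  obtain ⟨enc, dec, hdec⟩ := exists_coding (α := Fin 4 → ZMod q) (b := 4 * Nat.clog 2 q)
    (by simpa [ZMod.card] using card_pow_le_two_pow_clog q 4)
  obtain ⟨encE, decE, hdecE⟩ := exists_coding (α := EdgeMessage (ZMod q) n)
    (b := (2 * n + 3) * Nat.clog 2 q) (by
      refine le_trans (le_of_eq ?_) (card_pow_le_two_pow_clog q (2 * n + 3))
      simp only [Fintype.card_prod, Fintype.card_fun, ZMod.card, Fintype.card_fin]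
      ring)
  have hlt : ∀ (v : Fin n) (i : Fin (numPoints k n)), (v : ℕ) * numPoints k n + i < q := by
    intro v i
    have h1 : ((v : ℕ) + 1) * numPoints k n ≤ (n + 1) * numPoints k n :=
      Nat.mul_le_mul_right _ (by omega)
    have h2 := i.isLt
    rw [add_mul, one_mul] at h1
    omega
  refine ⟨{ point := fun v i => (((v : ℕ) * numPoints k n + i : ℕ) : ZMod q)
            point_inj := fun {u v i j} h => ?_
            grid := fun a => ((a : ℕ) : ZMod q)
            grid_inj := fun a a' h => ?_
            enc := enc, dec := dec, dec_enc := hdec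
            encEdge := encE, decEdge := decE, decEdge_encEdge := hdecE }⟩
  · have e := hcast _ _ (hlt u i) (hlt v j) h
    have hpos : 0 < numPoints k n := NeZero.pos _
    have e1 := congrArg (· / numPoints k n) e
    have e2 := congrArg (· % numPoints k n) e
    simp only [Nat.mul_comm _ (numPoints k n), Nat.mul_add_div hpos, Nat.mul_add_mod,
      Nat.div_eq_of_lt i.isLt, Nat.div_eq_of_lt j.isLt, Nat.mod_eq_of_lt i.isLt,
      Nat.mod_eq_of_lt j.isLt, add_zero] at e1 e2
    exact ⟨Fin.ext e1, Fin.ext e2⟩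
  · exact Fin.ext (hcast _ _ (by omega) (by omega) h)

/-- Rounding up costs at most one bit, which is at most `logb 2 q`; the constant works because `2 /
log 2 < 3`. -/
theorem clog_le_log {q : ℕ} (hq : 2 ≤ q) : (Nat.clog 2 q : ℝ) ≤ 3 * Real.log q := by
  have h1 : (Nat.clog 2 q : ℝ) ≤ Nat.log 2 q + 1 := by
    exact_mod_cast (Nat.clog_le_of_le_pow (Nat.lt_pow_succ_log_self one_lt_two q).le)
  have h2 : (Nat.log 2 q : ℝ) ≤ Real.logb 2 q := by exact_mod_cast Real.natLog_le_logb q 2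
  have h3 : Real.log 2 ≤ Real.log q := Real.log_le_log two_pos (by exact_mod_cast hq)
  have h4 := Real.log_two_gt_d9
  have h5 : Real.logb 2 q * Real.log 2 = Real.log q := div_mul_cancel₀ _ (by linarith)
  nlinarith

/-- The requirement is cubic in `n`, so it is eventually below `n ^ 4`. -/
theorem eventually_large {q : ℕ → ℕ} (hq : IsSuperpolynomial q) (k : ℕ) :
    ∀ᶠ n in atTop, (n + 1) * numPoints k n + k ≤ q n := by
  filter_upwards [hq 4, eventually_ge_atTop (k + 20)] with n h hn
  refine le_trans ?_ h
  have h1 : numPoints k n ≤ 9 * (n * n) := by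
    simp only [numPoints]
    nlinarith
  calc (n + 1) * numPoints k n + k ≤ (2 * n) * (9 * (n * n)) + n * (n * n) := by
        refine Nat.add_le_add (Nat.mul_le_mul (by omega) h1) ?_
        nlinarith [Nat.mul_le_mul (show 1 ≤ n by omega) (show 1 ≤ n by omega)]
    _ = 19 * (n * n * n) := by ring
    _ ≤ n * (n * n * n) := Nat.mul_le_mul_right _ (by omega)
    _ = n ^ 4 := by ring

end NonColorability

end

/-- Non-`k`-colorability has a statistical zero-knowledge distributed interactive proof with linearly
many rounds. -/
theorem mainTheorem2 (k : ℕ) :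
    ∃ C c : ℕ, ∀ q : ℕ → ℕ, (∀ n, (q n).Prime) → IsSuperpolynomial q →
      ∃ r l b : ℕ → ℕ,
        (∀ᶠ n in Filter.atTop,
          (r n : ℝ) ≤ C * (n : ℝ) ∧
          (l n : ℝ) ≤ C * Real.log (q n) ∧
          (b n : ℝ) ≤ C * ((n : ℝ) * Real.log (q n))) ∧
        nonColorability k ∈ dStatZK r l (fun _ => c) b := by
  -- `15 = 5 * 3`, from `2 * n + 3 ≤ 5 * n` and `clog_le_log`.
  refine ⟨15, 1, fun q hprime hq => ?_⟩
  -- Soundness is required for every `n`, but `q n` may be too small at first. A larger prime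
  -- replaces it there, which does not affect the eventual size bounds.
  have hex : ∀ n, ∃ p : ℕ, p.Prime ∧ (n + 1) * NonColorability.numPoints k n + k ≤ p ∧
      ((n + 1) * NonColorability.numPoints k n + k ≤ q n → p = q n) := fun n => by
    by_cases h : (n + 1) * NonColorability.numPoints k n + k ≤ q n
    · exact ⟨q n, hprime n, h, fun _ => rfl⟩
    · obtain ⟨p, hp, hpp⟩ :=
        Nat.exists_infinite_primes ((n + 1) * NonColorability.numPoints k n + k)
      exact ⟨p, hpp, hp, fun h' => absurd h' h⟩
  choose p hpprime hple hpq using hex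
  have : ∀ n, Fact (p n).Prime := fun n => ⟨hpprime n⟩
  have hS := fun n => (NonColorability.exists_setup n k (p n) (hple n)).some
  refine ⟨NonColorability.Setup.rounds, fun n => 4 * Nat.clog 2 (p n),
    fun n => (2 * n + 3) * Nat.clog 2 (p n), ?_, fun n => (hS n).verifier,
    fun n X => (hS n).honestProver X, fun n => (hS n).simulator, ⟨?_, ?_⟩, ?_⟩
  · filter_upwards [NonColorability.eventually_large hq k, eventually_ge_atTop 1] with n hn h1
    rw [hpq n hn]
    have hlog := NonColorability.clog_le_log (hprime n).two_le
    have hlog0 : 0 ≤ Real.log (q n) := Real.log_natCast_nonneg _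
    have h1' : (1 : ℝ) ≤ n := by exact_mod_cast h1
    refine ⟨?_, ?_, ?_⟩
    · push_cast [NonColorability.Setup.rounds]
      linarith
    · push_cast
      linarith
    · push_cast
      calc (2 * (n : ℝ) + 3) * (Nat.clog 2 (q n) : ℝ) ≤ (5 * n) * (3 * Real.log (q n)) := by
            gcongr
            linarith
        _ = _ := by ring
  · intro n X hX
    rw [(hS n).completeness X hX]
    norm_num
  · intro n X hX P'
    refine (hS n).soundness P' X (not_not.1 hX) ?_ le_rfl
    rw [ZMod.card]
    have := hple n
    nlinarith [Nat.zero_le (n * NonColorability.numPoints k n)]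
  · intro d
    filter_upwards [eventually_ge_atTop 2] with n hn X hX v
    rw [(hS n).simDist_eq_viewDist hn hX v, NonColorability.tvDist_self]
    positivity
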